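/- Let $G$ be a discrete group, $H\trianglelefteq G$ a finite normal subgroup, $G_0=G/H$, and let $\rho:H\to GL(F)$ be a finite-dimensional complex representation (equivalently $F=\bigoplus_k F_k\otimes V_k$, $\rho=\bigoplus_k \mathrm{Id}\otimes\rho_k$, with $\rho_k:H\to GL(V_k)$ irreducible). Let $u:G\to H$ be a map with $u(gh)=u(g)h$ for $g\in G$, $h\in H$. The canonical model is the vector bundle $X_\rho=G_0\times F\to G_0$ with the $G$-action $g_1\cdot([g],v)=([g_1g],\rho(u(g_1g)u(g)^{-1})v)$. Let $\mathrm{Aut}_G(X_\rho)$ be the topological group (compact-open topology on automorphisms and their inverses) of $G$-equivariant vector bundle automorphisms of $X_\rho$, which may cover nontrivial bijections of the base $G_0$. Let $X$ be a topological space. For a topological group $L$ let $\mathrm{Bundle}(X,L)$ be the category of locally trivial principal $L$-bundles over $X$ and continuous $L$-equivariant maps over $X$. For $M\in\mathrm{Bundle}(X,G_0)$, on which $G$ acts through $G_0$ (so that all stabilizers equal $H$), let $\mathrm{Vect}_G(M,\rho)$ be the category of complex $G$-equivariant vector bundles $\xi\to M$ such that every $G$-orbit in $M$ contains a point over which the representation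 of $H$ in the fibre of $\xi$ is isomorphic to $\rho$ (if $\rho$ is isomorphic to all of its conjugates $h\mapsto\rho(ghg^{-1})$, $g\in G$, this says that the representation of $H$ in every fibre is isomorphic to $\rho$); its morphisms are the $G$-equivariant isomorphisms of vector bundles over $M$. Let $\bigsqcup_{M\in\mathrm{Bundle}(X,G_0)}\mathrm{Vect}_G(M,\rho)$ be the category of pairs $(M,\xi)$ with $M\in\mathrm{Bundle}(X,G_0)$ and $\xi\in\mathrm{Vect}_G(M,\rho)$, in which a morphism $(M,\xi)\to(M',\xi')$ is a morphism $\varphi:M\to M'$ of $\mathrm{Bundle}(X,G_0)$ together with a $G$-equivariant vector bundle isomorphism $\xi\to\xi'$ covering $\varphi$. **Theorem.** If $X$ is compact, then there is an equivalence of categories $$\mathrm{Bundle}(X,\mathrm{Aut}_G(X_\rho))\;\simeq\;\bigsqcup_{M\in \mathrm{Bundle}(X,G_0)}\mathrm{Vect}_G(M,\rho).$$ It is given by replacing the fibre $\mathrm{Aut}_G(X_\rho)$ by $X_\rho$: if it sends $P$ to $(M,\xi)$, there is a map $P\times X_\rho\to\xi$ over $X$, natural in $P$, which covers a map $P\times G_0\to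 M$, is $G$-equivariant and a linear isomorphism on each fibre $\{p\}\times\{c\}\times F$, and identifies $\xi$, as a topological space, with the quotient $P\times_{\mathrm{Aut}_G(X_\rho)}X_\rho$. -/

import Mathlib

open CategoryTheory Topology Bundle

universe u

/-! ## Principal bundles -/

/-- A (locally trivial) principal `L`-bundle over `X`, with the structure group acting on the left of
the total space (a right action is recovered as `p · l = l⁻¹ • p`). -/
structure PrincipalBundle (L X : Type u) [Group L] [TopologicalSpace L] [TopologicalSpace X] :
    Type (u + 1) where
  /-- the total space -/
  P : Type u
  [top : TopologicalSpace P]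
  [act : MulAction L P]
  /-- the projection -/
  proj : P → X
  continuous_proj : Continuous proj
  continuous_smul : Continuous fun q : L × P => q.1 • q.2
  proj_smul : ∀ (l : L) (p : P), proj (l • p) = proj p
  locally_trivial : ∀ x : X, ∃ e : Trivialization L proj, x ∈ e.baseSet ∧
    ∀ p : P, proj p ∈ e.baseSet → ∀ l : L, (e (l • p)).2 = l * (e p).2

attribute [instance] PrincipalBundle.top PrincipalBundle.act

namespace PrincipalBundle

variable {L X : Type u} [Group L] [TopologicalSpace L] [TopologicalSpace X]

/-- Morphisms of principal bundles: continuous equivariant maps over `X`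
(these are automatically isomorphisms). -/
@[ext]
structure Hom (P Q : PrincipalBundle L X) where
  toFun : P.P → Q.P
  continuous_toFun : Continuous toFun
  map_smul : ∀ (l : L) (p : P.P), toFun (l • p) = l • toFun p
  proj_toFun : ∀ p : P.P, Q.proj (toFun p) = P.proj p

/-- The category `Bundle(X, L)` of principal `L`-bundles over `X`. -/
instance : Category (PrincipalBundle L X) where
  Hom P Q := Hom P Q
  id P := ⟨id, continuous_id, fun _ _ => rfl, fun _ => rfl⟩
  comp f g := ⟨g.toFun ∘ f.toFun, g.continuous_toFun.comp f.continuous_toFun,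
    fun l p => by simp [f.map_smul, g.map_smul],
    fun p => by simp [f.proj_toFun, g.proj_toFun]⟩

/-- The map of total spaces underlying a morphism of principal bundles. -/
def map {P Q : PrincipalBundle L X} (f : P ⟶ Q) : P.P → Q.P := Hom.toFun f

end PrincipalBundle

/-! ## The canonical model and its automorphism group -/

section Model

variable {G : Type u} [Group G] {H : Subgroup G}

/-- A homomorphism of right `H`-modules `u : G → H`. -/
structure RightModuleMap (H : Subgroup G) where
  toFun : G → H
  map_mul : ∀ (g : G) (h : H), toFun (g * h) = toFun g * h

/-- The element `u(g₁ g) u(g)⁻¹` of `H`, which depends only on `g₁` and on the class `[g]`. -/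
def RightModuleMap.cocycle (w : RightModuleMap H) (g₁ : G) (c : G ⧸ H) : H :=
  Quotient.liftOn' c (fun g => w.toFun (g₁ * g) * (w.toFun g)⁻¹) (by
    intro a b hab
    obtain ⟨h, rfl⟩ : ∃ h : H, b = a * h :=
      ⟨⟨a⁻¹ * b, QuotientGroup.leftRel_apply.mp hab⟩, by simp⟩
    simp only [← mul_assoc, w.map_mul]
    simp)

variable [TopologicalSpace G] [H.Normal]
  {F : Type u} [NormedAddCommGroup F] [NormedSpace ℂ F]

variable (H F) in
/-- The total space of the canonical model: the trivial bundle with fibre `F` over the discrete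
space `G₀ = G ⧸ H`. -/
abbrev CanonicalModel : Type u := (G ⧸ H) × F

/-- The canonical action of `G` on the canonical model: `g₁` maps the fibre over `[g]` to the fibre
over `[g₁ g]` by `ρ (u(g₁ g) u(g)⁻¹)`. -/
def canonicalAct (ρ : Representation ℂ H F) (w : RightModuleMap H) (g₁ : G)
    (x : CanonicalModel H F) : CanonicalModel H F :=
  ((g₁ : G ⧸ H) * x.1, ρ (w.cocycle g₁ x.1) x.2)

/-- `Aut_G(X_ρ)`: the group of `G`-equivariant automorphisms of the canonical model as a vector
bundle over `G ⧸ H` (an automorphism may cover a nontrivial bijection `a` of the base). -/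
def AutG (ρ : Representation ℂ H F) (w : RightModuleMap H) :
    Subgroup (CanonicalModel H F ≃ₜ CanonicalModel H F) where
  carrier := {A | (∀ g x, A (canonicalAct ρ w g x) = canonicalAct ρ w g (A x)) ∧
    ∃ (a : (G ⧸ H) ≃ (G ⧸ H)) (T : (G ⧸ H) → F ≃ₗ[ℂ] F), ∀ c v, A (c, v) = (a c, T c v)}
  mul_mem' := by
    rintro A B ⟨hA, a, S, hS⟩ ⟨hB, b, T, hT⟩
    refine ⟨fun g x => ?_, b.trans a, fun c => (T c).trans (S (b c)), fun c v => ?_⟩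
    · simp [hA, hB]
    · simp [hS, hT]
  one_mem' := ⟨fun _ _ => rfl, Equiv.refl _, fun _ => LinearEquiv.refl ℂ F, fun _ _ => rfl⟩
  inv_mem' := by
    rintro A ⟨hA, a, S, hS⟩
    refine ⟨fun g x => ?_, a.symm, fun c => (S (a.symm c)).symm, fun c v => ?_⟩
    · apply A.injective
      rw [hA]
      exact (A.apply_symm_apply _).trans (by rw [show A (A⁻¹ x) = x from A.apply_symm_apply x])
    · apply A.injective
      refine (A.apply_symm_apply _).trans ?_
      rw [hS, Equiv.apply_symm_apply, LinearEquiv.apply_symm_apply]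

/-- The topology of `Aut_G(X_ρ)`: the compact-open topology on the automorphisms and their
inverses. -/
instance (ρ : Representation ℂ H F) (w : RightModuleMap H) : TopologicalSpace (AutG ρ w) :=
  TopologicalSpace.induced
    (fun A : AutG ρ w =>
      (((A.1 : C(CanonicalModel H F, CanonicalModel H F))),
        ((A.1.symm : C(CanonicalModel H F, CanonicalModel H F)))))
    inferInstance

instance [DiscreteTopology G] [FiniteDimensional ℂ F]
    (ρ : Representation ℂ H F) (w : RightModuleMap H) : IsTopologicalGroup (AutG ρ w) := by
  have : ProperSpace F := FiniteDimensional.proper ℂ F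
  have h := continuous_induced_dom (t := inferInstance)
    (f := fun A : AutG ρ w =>
      (((A.1 : C(CanonicalModel H F, CanonicalModel H F))),
        ((A.1.symm : C(CanonicalModel H F, CanonicalModel H F)))))
  have h1 := continuous_fst.comp h
  have h2 := continuous_snd.comp h
  refine { continuous_mul := ?_, continuous_inv := ?_ }
  · refine continuous_induced_rng.mpr (Continuous.prodMk ?_ ?_)
    · exact (h1.comp continuous_fst).compCM (h1.comp continuous_snd)
    · exact (h2.comp continuous_snd).compCM (h2.comp continuous_fst)
  · exact continuous_induced_rng.mpr (Continuous.prodMk h2 h1)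

end Model

/-! ## Equivariant vector bundles -/

section Vect

variable {G : Type u} [Group G] [TopologicalSpace G] {H : Subgroup G} [H.Normal]
  {F : Type u} [NormedAddCommGroup F] [NormedSpace ℂ F]
  {X : Type u} [TopologicalSpace X]

/-- The objects of `Vect_G(M, ρ)`: complex `G`-equivariant vector bundles over the principal
`G ⧸ H`-bundle `M`, where `G` acts on `M` through `G ⧸ H` (so all stabilizers in `M` are equal
to `H`), such that every `G`-orbit in `M` contains a point over which the representation of `H` in
the fibre is isomorphic to `ρ`. -/
structure VectG (ρ : Representation ℂ H F) (M : PrincipalBundle (G ⧸ H) X) : Type (u + 1) where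
  /-- the fibres -/
  E : M.P → Type u
  [addCommGroup : ∀ m, AddCommGroup (E m)]
  [module : ∀ m, Module ℂ (E m)]
  [topFibre : ∀ m, TopologicalSpace (E m)]
  [topTotal : TopologicalSpace (TotalSpace F E)]
  [fiberBundle : FiberBundle F E]
  [vectorBundle : VectorBundle ℂ F E]
  /-- the action of `g` as a linear map from the fibre over `m` to the fibre over `g • m` -/
  lin : ∀ (g : G) (m : M.P), E m →ₗ[ℂ] E ((g : G ⧸ H) • m)
  one_act : ∀ (m : M.P) (v : E m),
    (⟨((1 : G) : G ⧸ H) • m, lin 1 m v⟩ : TotalSpace F E) = ⟨m, v⟩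
  mul_act : ∀ (g g' : G) (m : M.P) (v : E m),
    (⟨((g * g' : G) : G ⧸ H) • m, lin (g * g') m v⟩ : TotalSpace F E) =
      ⟨(g : G ⧸ H) • (g' : G ⧸ H) • m, lin g _ (lin g' m v)⟩
  continuous_act : ∀ g : G, Continuous fun e : TotalSpace F E =>
    (⟨(g : G ⧸ H) • e.proj, lin g e.proj e.2⟩ : TotalSpace F E)
  type_rho : ∀ m : M.P, ∃ (c : G ⧸ H) (T : F ≃ₗ[ℂ] E (c • m)), ∀ (h : H) (v : F),
    (⟨((h : G) : G ⧸ H) • c • m, lin h (c • m) (T v)⟩ : TotalSpace F E) = ⟨c • m, T (ρ h v)⟩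

attribute [instance] VectG.addCommGroup VectG.module VectG.topFibre VectG.topTotal
  VectG.fiberBundle VectG.vectorBundle

namespace VectG

variable {ρ : Representation ℂ H F}

/-- The total space of an equivariant vector bundle. -/
abbrev Total {M : PrincipalBundle (G ⧸ H) X} (ξ : VectG ρ M) : Type u := TotalSpace F ξ.E

/-- The action of `g ∈ G` on the total space. -/
def act {M : PrincipalBundle (G ⧸ H) X} (ξ : VectG ρ M) (g : G) (e : ξ.Total) : ξ.Total :=
  ⟨(g : G ⧸ H) • e.proj, ξ.lin g e.proj e.2⟩

/-- If `ρ` is isomorphic to all its conjugates by elements of `G`, then over *every* point of `M` the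
representation of `H` in the fibre is isomorphic to `ρ`. -/
theorem fibre_iso_of_invariant
    (hρ : ∀ g : G, ∃ S : F ≃ₗ[ℂ] F, ∀ (h : H) (v : F),
      S (ρ h v) = ρ ⟨g * h * g⁻¹, ‹H.Normal›.conj_mem h h.2 g⟩ (S v))
    {M : PrincipalBundle (G ⧸ H) X} (ξ : VectG ρ M) (m : M.P) :
    ∃ T : F ≃ₗ[ℂ] ξ.E m, ∀ (h : H) (v : F), ξ.act h ⟨m, T v⟩ = ⟨m, T (ρ h v)⟩ := by
  obtain ⟨c, T, hT⟩ := ξ.type_rho m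
  obtain ⟨g, rfl⟩ := QuotientGroup.mk_surjective c
  have hm : ((g⁻¹ : G) : G ⧸ H) • (g : G ⧸ H) • m = m := by
    rw [← mul_smul, ← QuotientGroup.mk_mul]; simp
  obtain ⟨m', hm'⟩ : ∃ m', (g : G ⧸ H) • m = m' := ⟨_, rfl⟩
  rw [hm'] at hm T
  subst hm
  revert T
  rw [hm']
  intro T hT
  have aone : ∀ e, ξ.act 1 e = e := fun e => ξ.one_act e.proj e.2
  have amul : ∀ a b e, ξ.act (a * b) e = ξ.act a (ξ.act b e) := fun a b e =>
    ξ.mul_act a b e.proj e.2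
  have key : ∀ v, ξ.act g⁻¹ ⟨m', v⟩ = ⟨((g⁻¹ : G) : G ⧸ H) • m', ξ.lin g⁻¹ m' v⟩ := fun v => rfl
  have hbij : Function.Bijective (ξ.lin g⁻¹ m') := by
    refine ⟨fun v v' hv => ?_, fun z => ?_⟩
    · have h1 : ξ.act g⁻¹ ⟨m', v⟩ = ξ.act g⁻¹ ⟨m', v'⟩ := by rw [key, key, hv]
      have h2 := congrArg (ξ.act g) h1
      rw [← amul, ← amul, mul_inv_cancel, aone, aone] at h2
      simpa using h2
    · obtain ⟨⟨n, v⟩, hv⟩ : ∃ e, e = ξ.act g ⟨((g⁻¹ : G) : G ⧸ H) • m', z⟩ := ⟨_, rfl⟩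
      have hn : n = m' := by
        have := congrArg TotalSpace.proj hv
        refine this.trans ?_
        change (g : G ⧸ H) • ((g⁻¹ : G) : G ⧸ H) • m' = m'
        rw [← mul_smul, ← QuotientGroup.mk_mul]; simp
      subst hn
      refine ⟨v, ?_⟩
      have h2 := congrArg (ξ.act g⁻¹) hv
      rw [← amul, inv_mul_cancel, aone, key] at h2
      exact eq_of_heq (TotalSpace.mk.inj h2).2
  obtain ⟨S, hS⟩ := hρ g
  refine ⟨S.trans (T.trans (LinearEquiv.ofBijective _ hbij)), fun h v => ?_⟩
  simp only [LinearEquiv.trans_apply, LinearEquiv.ofBijective_apply, ← key, ← amul, hS]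
  rw [← hT ⟨g * h * g⁻¹, ‹H.Normal›.conj_mem h h.2 g⟩]
  change _ = ξ.act g⁻¹ (ξ.act (g * h * g⁻¹) ⟨m', T (S v)⟩)
  rw [← amul]
  simp [mul_assoc]

/-- Isomorphisms of `G`-equivariant vector bundles covering a morphism `φ : M ⟶ M'` of principal
`G ⧸ H`-bundles over `X`: continuous `G`-maps of the total spaces which are linear isomorphisms on
the fibres. -/
@[ext]
structure HomOver {M M' : PrincipalBundle (G ⧸ H) X} (φ : M ⟶ M') (ξ : VectG ρ M)
    (ξ' : VectG ρ M') where
  fib : ∀ m : M.P, ξ.E m ≃ₗ[ℂ] ξ'.E (PrincipalBundle.map φ m)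
  continuous_total : Continuous fun e : ξ.Total =>
    (⟨PrincipalBundle.map φ e.proj, fib e.proj e.2⟩ : ξ'.Total)
  equivariant : ∀ (g : G) (e : ξ.Total),
    (⟨PrincipalBundle.map φ (ξ.act g e).proj, fib (ξ.act g e).proj (ξ.act g e).2⟩ : ξ'.Total) =
      ξ'.act g ⟨PrincipalBundle.map φ e.proj, fib e.proj e.2⟩

namespace HomOver

variable {M M' M'' : PrincipalBundle (G ⧸ H) X} {φ : M ⟶ M'} {ψ : M' ⟶ M''}
  {ξ : VectG ρ M} {ξ' : VectG ρ M'} {ξ'' : VectG ρ M''}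

/-- The map of total spaces. -/
def total (f : HomOver φ ξ ξ') (e : ξ.Total) : ξ'.Total :=
  ⟨PrincipalBundle.map φ e.proj, f.fib e.proj e.2⟩

/-- The identity. -/
protected def id (ξ : VectG ρ M) : HomOver (𝟙 M) ξ ξ where
  fib m := LinearEquiv.refl ℂ (ξ.E m)
  continuous_total := continuous_id
  equivariant _ _ := rfl

/-- Composition. -/
protected def comp (f : HomOver φ ξ ξ') (f' : HomOver ψ ξ' ξ'') : HomOver (φ ≫ ψ) ξ ξ'' where
  fib m := (f.fib m).trans (f'.fib (PrincipalBundle.map φ m))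
  continuous_total := f'.continuous_total.comp f.continuous_total
  equivariant g e :=
    (congrArg f'.total (f.equivariant g e)).trans (f'.equivariant g (f.total e))

end HomOver

/-- The category `Vect_G(M, ρ)` over a fixed `M`: the morphisms cover the identity of `M`. -/
instance (M : PrincipalBundle (G ⧸ H) X) : Category (VectG ρ M) where
  Hom ξ ξ' := HomOver (𝟙 M) ξ ξ'
  id ξ := HomOver.id ξ
  comp f g := HomOver.comp f g

end VectG

variable (X) in
/-- The disjoint union of the categories `Vect_G(M, ρ)`, indexed by the category of principal
`G ⧸ H`-bundles `M` over `X`: an object is a pair `(M, ξ)` with `ξ` in `Vect_G(M, ρ)`. -/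
structure VectGUnion (ρ : Representation ℂ H F) : Type (u + 1) where
  M : PrincipalBundle (G ⧸ H) X
  ξ : VectG ρ M

namespace VectGUnion

variable {ρ : Representation ℂ H F}

/-- A morphism `(M, ξ) ⟶ (M', ξ')` is a morphism `φ : M ⟶ M'` of principal bundles together with
an isomorphism of `G`-equivariant vector bundles `ξ → ξ'` covering it. -/
structure Hom (V W : VectGUnion X ρ) where
  base : V.M ⟶ W.M
  lift : VectG.HomOver base V.ξ W.ξ

instance : Category (VectGUnion X ρ) where
  Hom V W := Hom V W
  id V := ⟨𝟙 V.M, VectG.HomOver.id V.ξ⟩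
  comp f g := ⟨f.base ≫ g.base, f.lift.comp g.lift⟩

/-- The map of total spaces underlying a morphism. -/
def mapTotal {V W : VectGUnion X ρ} (f : V ⟶ W) : V.ξ.Total → W.ξ.Total :=
  (Hom.lift f).total

end VectGUnion

/-- The data exhibiting `(M, ξ)` as the bundle associated with the principal `Aut_G(X_ρ)`-bundle `P`
with fibre the canonical model `X_ρ → G ⧸ H`: a map `P × X_ρ → ξ` over `X`, covering a map
`P × (G ⧸ H) → M`, linear isomorphic on the fibres, `G`-equivariant, which identifies `ξ` with the
quotient of `P × X_ρ` by the diagonal action of `Aut_G(X_ρ)`. -/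
structure AssociatedBundle {ρ : Representation ℂ H F} {w : RightModuleMap H}
    (P : PrincipalBundle (AutG ρ w) X) (V : VectGUnion X ρ) where
  base : P.P → G ⧸ H → V.M.P
  fib : ∀ (p : P.P) (c : G ⧸ H), F ≃ₗ[ℂ] V.ξ.E (base p c)
  proj_base : ∀ p c, V.M.proj (base p c) = P.proj p
  isQuotientMap : IsQuotientMap fun q : P.P × CanonicalModel H F =>
    (⟨base q.1 q.2.1, fib q.1 q.2.1 q.2.2⟩ : V.ξ.Total)
  eq_iff : ∀ (p p' : P.P) (x x' : CanonicalModel H F),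
    (⟨base p x.1, fib p x.1 x.2⟩ : V.ξ.Total) = ⟨base p' x'.1, fib p' x'.1 x'.2⟩ ↔
      ∃ A : AutG ρ w, p' = A • p ∧ x' = A.1 x
  equivariant : ∀ (g : G) (p : P.P) (x : CanonicalModel H F),
    (⟨base p (canonicalAct ρ w g x).1, fib p (canonicalAct ρ w g x).1 (canonicalAct ρ w g x).2⟩ :
      V.ξ.Total) = V.ξ.act g ⟨base p x.1, fib p x.1 x.2⟩

/-- The map `P × X_ρ → ξ`. -/
def AssociatedBundle.eval {ρ : Representation ℂ H F} {w : RightModuleMap H}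
    {P : PrincipalBundle (AutG ρ w) X} {V : VectGUnion X ρ} (a : AssociatedBundle P V) (p : P.P)
    (x : CanonicalModel H F) : V.ξ.Total :=
  ⟨a.base p x.1, a.fib p x.1 x.2⟩

end Vect

/-! Call a `G`-equivariant, fibrewise linear isomorphism from `X_ρ` onto the restriction of `ξ` to
the fibre of `M` over `x` a frame at `x`. Two frames at `x` differ by an element of `Aut_G(X_ρ)`
(`IsFrame.exists_transition`), unique because frames are injective. So the frames of `ξ` should form
a principal bundle `P`, and `ξ` is recovered as `P ×_{Aut_G(X_ρ)} X_ρ`.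

Two points need work. Frames must exist locally and continuously (`exists_local_frame`): over a
local section of `M` through a point of type `ρ`, averaging over the finite group `H` makes a
trivialization of `ξ` equivariant, and the action of `G` spreads it to the other cosets. And
transition functions must be continuous into `Aut_G(X_ρ)`: since `F` is finite-dimensional and `G ⧸
H` discrete, its topology is that of pointwise convergence (`AutG.isInducing_apply`), so continuity
can be tested on single vectors.

Conversely, the cocycle of `P` acts on `X_ρ` and glues an object `(M, ξ)`
(`nonempty_associatedBundle`). Each point of `P` is then a frame of `ξ`. Morphisms carry frames to
frames, which gives full faithfulness (`exists_principal_hom`, `eval_left_injective`); local frames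
give essential surjectivity. -/

/-- Openness of `O` is local, and near each point `O` is the preimage of `f ⁻¹' O` under a
continuous local section. -/
theorem isQuotientMap_of_local_sections {A B : Type*} [TopologicalSpace A] [TopologicalSpace B]
    {f : A → B} (hf : Continuous f)
    (h : ∀ b : B, ∃ N : Set B, IsOpen N ∧ b ∈ N ∧ ∃ s : B → A, ContinuousOn s N ∧
      ∀ b' ∈ N, f (s b') = b') : IsQuotientMap f := by
  have hsurj : Function.Surjective f := fun b => by
    obtain ⟨N, -, hb, s, -, hs⟩ := h b
    exact ⟨s b, hs b hb⟩
  refine ⟨.of_isOpen_preimage_iff_isOpen fun O => ⟨fun hO => ?_, fun hO => hO.preimage hf⟩, hsurj⟩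
  refine isOpen_iff_mem_nhds.mpr fun b hb => ?_
  obtain ⟨N, hN, hbN, s, hsc, hs⟩ := h b
  have h1 : IsOpen (N ∩ s ⁻¹' (f ⁻¹' O)) := hsc.isOpen_inter_preimage hN hO
  refine Filter.mem_of_superset (h1.mem_nhds ⟨hbN, ?_⟩) ?_
  · simpa [hs b hbN] using hb
  · rintro b' ⟨h2, h3⟩
    simpa [hs b' h2] using h3

/-! ### Principal bundles: division in fibres and local sections -/

namespace PrincipalBundle

variable {L X : Type u} [Group L] [TopologicalSpace L] [TopologicalSpace X]

section

variable (P : PrincipalBundle L X)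

theorem existsUnique_smul_eq {p q : P.P} (h : P.proj p = P.proj q) : ∃! l : L, q = l • p := by
  obtain ⟨e, he, hl⟩ := P.locally_trivial (P.proj p)
  refine ⟨(e q).2 * ((e p).2)⁻¹, ?_, fun l hq => ?_⟩
  · refine e.injOn (e.mem_source.mpr (h ▸ he)) (e.mem_source.mpr ?_) (Prod.ext ?_ ?_)
    · rw [P.proj_smul]; exact he
    · refine (e.coe_fst' (h ▸ he)).trans ?_
      refine Eq.trans ?_ (e.coe_fst' (by rw [P.proj_smul]; exact he)).symm
      rw [P.proj_smul, h]
    · exact Eq.trans (by simp) (hl p he _).symm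
  · rw [hq, hl p he]; simp

theorem smul_left_injective (p : P.P) : Function.Injective fun l : L => l • p := fun l _ h =>
  (P.existsUnique_smul_eq (P.proj_smul l p).symm).unique rfl h

open Classical in
/-- The element `l` of the structure group with `q = l • p`, if `p` and `q` lie in the same
fibre. -/
noncomputable def div (q p : P.P) : L :=
  if h : P.proj p = P.proj q then (P.existsUnique_smul_eq h).exists.choose else 1

theorem div_smul {p q : P.P} (h : P.proj p = P.proj q) : P.div q p • p = q := by
  rw [div, dif_pos h]
  exact (P.existsUnique_smul_eq h).exists.choose_spec.symm

theorem div_eq {p q : P.P} {l : L} (h : q = l • p) : P.div q p = l := by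
  have h' : P.proj p = P.proj q := by rw [h, P.proj_smul]
  exact P.smul_left_injective p ((P.div_smul h').trans h)

@[simp]
theorem div_self (p : P.P) : P.div p p = 1 := P.div_eq (one_smul L p).symm

theorem div_mul_div {p q r : P.P} (h : P.proj p = P.proj q) (h' : P.proj q = P.proj r) :
    P.div r q * P.div q p = P.div r p :=
  (P.div_eq (by rw [mul_smul, P.div_smul h, P.div_smul h'])).symm

theorem smul_div {p q : P.P} (h : P.proj p = P.proj q) (l : L) :
    P.div (l • q) p = l * P.div q p :=
  P.div_eq (by rw [mul_smul, P.div_smul h])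

/-- In a local trivialization division is `(e q).2 * ((e p).2)⁻¹`, which is continuous in a
topological group. -/
theorem continuousOn_div [IsTopologicalGroup L] {Y : Type*} [TopologicalSpace Y] {f g : Y → P.P}
    {S : Set Y} (hf : ContinuousOn f S) (hg : ContinuousOn g S)
    (h : ∀ y ∈ S, P.proj (g y) = P.proj (f y)) : ContinuousOn (fun y => P.div (f y) (g y)) S := by
  intro y₀ hy₀
  obtain ⟨e, he, hl⟩ := P.locally_trivial (P.proj (f y₀))
  have key : ∀ y ∈ S, P.proj (f y) ∈ e.baseSet →
      P.div (f y) (g y) = (e (f y)).2 * ((e (g y)).2)⁻¹ := by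
    intro y hy hye
    have h1 := hl (g y) (by rw [h y hy]; exact hye) (P.div (f y) (g y))
    rw [P.div_smul (h y hy)] at h1
    rw [h1]; simp
  have hcf : ContinuousWithinAt (fun y => (e (f y)).2) S y₀ :=
    continuousAt_snd.comp_continuousWithinAt
      ((e.continuousAt (e.mem_source.mpr he)).comp_continuousWithinAt (hf y₀ hy₀))
  have hcg : ContinuousWithinAt (fun y => (e (g y)).2) S y₀ :=
    continuousAt_snd.comp_continuousWithinAt
      ((e.continuousAt (e.mem_source.mpr (by rw [h y₀ hy₀]; exact he))).comp_continuousWithinAt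
        (hg y₀ hy₀))
  refine (hcf.mul hcg.inv).congr_of_eventuallyEq ?_ (key y₀ hy₀ he)
  have h2 : ∀ᶠ y in 𝓝[S] y₀, P.proj (f y) ∈ e.baseSet :=
    (P.continuous_proj.continuousAt.comp_continuousWithinAt (hf y₀ hy₀)).eventually
      (e.open_baseSet.mem_nhds he)
  filter_upwards [h2, self_mem_nhdsWithin] with y hy hyS using key y hyS hy

theorem exists_section (x : X) : ∃ U : Set X, IsOpen U ∧ x ∈ U ∧ ∃ s : X → P.P,
    ContinuousOn s U ∧ ∀ y ∈ U, P.proj (s y) = y := by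
  obtain ⟨e, he, -⟩ := P.locally_trivial x
  refine ⟨e.baseSet, e.open_baseSet, he, fun y => e.toOpenPartialHomeomorph.symm (y, 1), ?_,
    fun y hy => e.proj_symm_apply' hy⟩
  exact e.continuousOn_invFun.comp (by fun_prop) fun y hy => e.mem_target.mpr hy

theorem continuous_const_smul (l : L) : Continuous fun p : P.P => l • p :=
  P.continuous_smul.comp (by fun_prop : Continuous fun p : P.P => (l, p))

/-- Any local section can be moved by the constant element of `L` that takes its value over `P.proj
p` to `p`. -/
theorem exists_section_through (p : P.P) : ∃ U : Set X, IsOpen U ∧ P.proj p ∈ U ∧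
    ∃ s : X → P.P, ContinuousOn s U ∧ (∀ y ∈ U, P.proj (s y) = y) ∧ s (P.proj p) = p := by
  obtain ⟨U, hU, hx, s, hs, hps⟩ := P.exists_section (P.proj p)
  refine ⟨U, hU, hx, fun y => P.div p (s (P.proj p)) • s y,
    (P.continuous_const_smul _).comp_continuousOn hs, fun y hy => ?_, P.div_smul (hps _ hx)⟩
  rw [P.proj_smul, hps y hy]

theorem surjective_proj : Function.Surjective P.proj := fun x =>
  let ⟨_, _, hx, s, _, hs⟩ := P.exists_section x
  ⟨s x, hs x hx⟩

end

@[ext]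
theorem hom_ext {P Q : PrincipalBundle L X} {f g : P ⟶ Q} (h : ∀ p, map f p = map g p) : f = g :=
  Hom.ext (funext h)

@[simp]
theorem map_id (P : PrincipalBundle L X) (p : P.P) : map (𝟙 P) p = p := rfl

@[simp]
theorem map_comp {P Q R : PrincipalBundle L X} (f : P ⟶ Q) (g : Q ⟶ R) (p : P.P) :
    map (f ≫ g) p = map g (map f p) := rfl

theorem map_smul {P Q : PrincipalBundle L X} (f : P ⟶ Q) (l : L) (p : P.P) :
    map f (l • p) = l • map f p := Hom.map_smul f l p

theorem proj_map {P Q : PrincipalBundle L X} (f : P ⟶ Q) (p : P.P) :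
    Q.proj (map f p) = P.proj p := Hom.proj_toFun f p

theorem continuous_map {P Q : PrincipalBundle L X} (f : P ⟶ Q) : Continuous (map f) :=
  Hom.continuous_toFun f

/-! ### Čech cocycles and the principal bundles glued from them -/

variable (L X) in
/-- An `L`-valued Čech cocycle on an open cover of `X` indexed by the points of `X`. -/
structure Cocycle where
  baseSet : X → Set X
  isOpen_baseSet : ∀ i, IsOpen (baseSet i)
  mem_baseSet : ∀ x, x ∈ baseSet x
  g : X → X → X → L
  continuousOn_g : ∀ i j, ContinuousOn (g i j) (baseSet i ∩ baseSet j)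
  g_self : ∀ i, ∀ x ∈ baseSet i, g i i x = 1
  g_mul_g : ∀ i j k x, x ∈ baseSet i → x ∈ baseSet j → x ∈ baseSet k →
    g i j x * g j k x = g i k x

namespace Cocycle

variable (c : Cocycle L X)

theorem g_mul_g_symm {i j x : X} (hi : x ∈ c.baseSet i) (hj : x ∈ c.baseSet j) :
    c.g i j x * c.g j i x = 1 := by
  rw [c.g_mul_g i j i x hi hj hi, c.g_self i x hi]

variable [IsTopologicalGroup L]

/-- The fibre bundle with fibre `L` glued by right translations. -/
def core : FiberBundleCore X X L where
  baseSet := c.baseSet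
  isOpen_baseSet := c.isOpen_baseSet
  indexAt := id
  mem_baseSet_at := c.mem_baseSet
  -- Right translations commute with left multiplication, so the left action of `L` is the same in
  -- every chart.
  coordChange i j x l := l * c.g i j x
  coordChange_self i x hx l := by simp [c.g_self i x hx]
  continuousOn_coordChange i j :=
    continuousOn_snd.mul ((c.continuousOn_g i j).comp continuousOn_fst fun _ h => h.1)
  coordChange_comp i j k x hx l := by
    rw [mul_assoc, c.g_mul_g i j k x hx.1.1 hx.1.2 hx.2]

/-- The point of the glued bundle over `x` with coordinate `l` in the open set indexed by `x`. -/
def corePt (x : X) (l : L) : TotalSpace L c.core.Fiber := ⟨x, l⟩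

/-- The coordinate of a point over `x` in the open set indexed by `x`. -/
def coreVal (p : TotalSpace L c.core.Fiber) : L := p.2

@[simp]
theorem corePt_coreVal (p : TotalSpace L c.core.Fiber) : c.corePt p.proj (c.coreVal p) = p := rfl

/-- The coordinate of a point of the glued bundle over the `i`-th open set. -/
def coreCoord (i : X) (p : TotalSpace L c.core.Fiber) : L := (c.core.localTriv i p).2

theorem coreCoord_eq (i : X) (p : TotalSpace L c.core.Fiber) :
    c.coreCoord i p = c.coreVal p * c.g p.proj i p.proj := rfl

theorem continuousOn_coreCoord (i : X) :
    ContinuousOn (c.coreCoord i) {p : TotalSpace L c.core.Fiber | p.proj ∈ c.baseSet i} :=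
  continuous_snd.comp_continuousOn
    ((c.core.localTriv i).continuousOn.mono fun p hp => (c.core.mem_localTriv_source i p).mpr hp)

/-- The point of the glued bundle with given coordinate over the `i`-th open set. -/
def coreOfCoord (i : X) (q : X × L) : TotalSpace L c.core.Fiber :=
  c.corePt q.1 (q.2 * c.g i q.1 q.1)

theorem continuousOn_coreOfCoord (i : X) :
    ContinuousOn (c.coreOfCoord i) {q : X × L | q.1 ∈ c.baseSet i} :=
  (c.core.localTriv i).continuousOn_invFun.mono fun q hq =>
    (c.core.mem_localTriv_target i q).mpr hq

theorem coreOfCoord_coreCoord {i : X} {p : TotalSpace L c.core.Fiber} (h : p.proj ∈ c.baseSet i) :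
    c.coreOfCoord i (p.proj, c.coreCoord i p) = p := by
  rw [coreOfCoord, coreCoord_eq, mul_assoc, c.g_mul_g_symm (c.mem_baseSet _) h, mul_one,
    corePt_coreVal]

/-- Over the `i`-th open set, projection and `i`-th coordinate together are inverse to `coreOfCoord
i`, so one fixed chart suffices, although `coreVal` changes its index from point to point. -/
theorem continuousAt_core_iff {Y : Type*} [TopologicalSpace Y] {f : Y → TotalSpace L c.core.Fiber}
    {y : Y} {i : X} (hi : (f y).proj ∈ c.baseSet i) :
    ContinuousAt f y ↔ ContinuousAt (fun y => (f y).proj) y ∧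
      ContinuousAt (fun y => c.coreCoord i (f y)) y := by
  have hO : IsOpen {p : TotalSpace L c.core.Fiber | p.proj ∈ c.baseSet i} :=
    (c.isOpen_baseSet i).preimage c.core.continuous_proj
  have hO' : IsOpen {q : X × L | q.1 ∈ c.baseSet i} :=
    (c.isOpen_baseSet i).preimage continuous_fst
  constructor
  · intro h
    exact ⟨c.core.continuous_proj.continuousAt.comp h,
      ((c.continuousOn_coreCoord i).continuousAt (hO.mem_nhds hi)).comp h⟩
  · rintro ⟨h1, h2⟩
    have h3 : ContinuousAt (fun y => c.coreOfCoord i ((f y).proj, c.coreCoord i (f y))) y :=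
      ContinuousAt.comp (f := fun y => ((f y).proj, c.coreCoord i (f y))) (x := y)
        ((c.continuousOn_coreOfCoord i).continuousAt (hO'.mem_nhds hi)) (h1.prodMk h2)
    refine h3.congr ?_
    filter_upwards [h1.eventually ((c.isOpen_baseSet i).mem_nhds hi)] with y hy
      using c.coreOfCoord_coreCoord hy

/-- The principal bundle glued from a cocycle. -/
def bundle : PrincipalBundle L X where
  P := TotalSpace L c.core.Fiber
  act :=
    { smul := fun l p => c.corePt p.proj (l * c.coreVal p)
      one_smul := fun p => congrArg (c.corePt p.proj) (one_mul (c.coreVal p))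
      mul_smul := fun l l' p => congrArg (c.corePt p.proj) (mul_assoc l l' (c.coreVal p)) }
  proj := TotalSpace.proj
  continuous_proj := c.core.continuous_proj
  proj_smul _ _ := rfl
  continuous_smul := by
    refine continuous_iff_continuousAt.mpr fun ⟨l₀, p₀⟩ => ?_
    have hO : IsOpen {p : TotalSpace L c.core.Fiber | p.proj ∈ c.baseSet p₀.proj} :=
      (c.isOpen_baseSet _).preimage c.core.continuous_proj
    refine (c.continuousAt_core_iff (i := p₀.proj) (c.mem_baseSet _)).mpr ⟨?_, ?_⟩
    · exact (c.core.continuous_proj.comp continuous_snd).continuousAt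
    · have : ContinuousAt (fun q : L × TotalSpace L c.core.Fiber =>
          q.1 * c.coreCoord p₀.proj q.2) (l₀, p₀) :=
        continuousAt_fst.mul (ContinuousAt.comp (f := Prod.snd) (x := (l₀, p₀))
          ((c.continuousOn_coreCoord _).continuousAt (hO.mem_nhds (c.mem_baseSet _)))
          continuousAt_snd)
      exact this.congr (.of_forall fun q => (mul_assoc _ _ _).symm)
  locally_trivial x := ⟨c.core.localTriv x, c.mem_baseSet x, fun _ _ _ => mul_assoc _ _ _⟩

/-- The point of the glued bundle over `x` with coordinate `l` in the open set indexed by `x`. -/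
def pt (x : X) (l : L) : c.bundle.P := c.corePt x l

/-- The coordinate of a point over `x` in the open set indexed by `x`. -/
def val (p : c.bundle.P) : L := c.coreVal p

/-- The coordinate of a point of the glued bundle over the `i`-th open set. -/
def coord (i : X) (p : c.bundle.P) : L := c.val p * c.g (c.bundle.proj p) i (c.bundle.proj p)

@[simp]
theorem val_smul (l : L) (p : c.bundle.P) : c.val (l • p) = l * c.val p := rfl

theorem coord_proj (p : c.bundle.P) : c.coord (c.bundle.proj p) p = c.val p := by
  rw [coord, c.g_self _ _ (c.mem_baseSet _), mul_one]

theorem continuousOn_coord (i : X) :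
    ContinuousOn (c.coord i) {p | c.bundle.proj p ∈ c.baseSet i} := c.continuousOn_coreCoord i

theorem continuousAt_iff {Y : Type*} [TopologicalSpace Y] {f : Y → c.bundle.P} {y : Y} {i : X}
    (hi : c.bundle.proj (f y) ∈ c.baseSet i) :
    ContinuousAt f y ↔ ContinuousAt (fun y => c.bundle.proj (f y)) y ∧
      ContinuousAt (fun y => c.coord i (f y)) y := c.continuousAt_core_iff hi

theorem coord_mul_g {i j : X} {p : c.bundle.P} (hi : c.bundle.proj p ∈ c.baseSet i)
    (hj : c.bundle.proj p ∈ c.baseSet j) :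
    c.coord i p * c.g i j (c.bundle.proj p) = c.coord j p := by
  rw [coord, coord, mul_assoc, c.g_mul_g _ i j _ (c.mem_baseSet _) hi hj]

/-- The section of the glued bundle with coordinate `1` over the `i`-th open set. -/
def unitSection (i x : X) : c.bundle.P := c.pt x (c.g i x x)

theorem continuousOn_unitSection (i : X) : ContinuousOn (c.unitSection i) (c.baseSet i) := by
  intro x hx
  refine ContinuousAt.continuousWithinAt ((c.continuousAt_iff (f := c.unitSection i) hx).mpr
    ⟨continuousAt_id, (continuousAt_const (y := (1 : L))).congr ?_⟩)
  filter_upwards [(c.isOpen_baseSet i).mem_nhds hx] with y hy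
  exact (c.g_mul_g_symm hy (c.mem_baseSet y)).symm

end Cocycle

section

variable (P : PrincipalBundle L X)

/-- A choice of a local section around each point. -/
noncomputable def sectionNhd (x : X) : Set X := (P.exists_section x).choose

theorem isOpen_sectionNhd (x : X) : IsOpen (P.sectionNhd x) := (P.exists_section x).choose_spec.1

theorem mem_sectionNhd (x : X) : x ∈ P.sectionNhd x := (P.exists_section x).choose_spec.2.1

/-- The chosen local section around `x`. -/
noncomputable def sectionAt (x : X) : X → P.P := (P.exists_section x).choose_spec.2.2.choose

theorem continuousOn_sectionAt (x : X) : ContinuousOn (P.sectionAt x) (P.sectionNhd x) :=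
  (P.exists_section x).choose_spec.2.2.choose_spec.1

theorem proj_sectionAt {x y : X} (h : y ∈ P.sectionNhd x) : P.proj (P.sectionAt x y) = y :=
  (P.exists_section x).choose_spec.2.2.choose_spec.2 y h

/-- The transition cocycle of the chosen local sections. -/
noncomputable def cocycle [IsTopologicalGroup L] : Cocycle L X where
  baseSet := P.sectionNhd
  isOpen_baseSet := P.isOpen_sectionNhd
  mem_baseSet := P.mem_sectionNhd
  g i j x := P.div (P.sectionAt i x) (P.sectionAt j x)
  continuousOn_g i j := P.continuousOn_div ((P.continuousOn_sectionAt i).mono fun _ h => h.1)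
    ((P.continuousOn_sectionAt j).mono fun _ h => h.2) fun _ h => by
      rw [P.proj_sectionAt h.1, P.proj_sectionAt h.2]
  g_self i x _ := P.div_self _
  g_mul_g i j k x hi hj hk := P.div_mul_div
    (by rw [P.proj_sectionAt hk, P.proj_sectionAt hj])
    (by rw [P.proj_sectionAt hj, P.proj_sectionAt hi])

end

/-- The pushforward of a cocycle along a continuous homomorphism. -/
def Cocycle.map {L' : Type u} [Group L'] [TopologicalSpace L'] (c : Cocycle L X) (β : L →* L')
    (hβ : Continuous β) : Cocycle L' X where
  baseSet := c.baseSet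
  isOpen_baseSet := c.isOpen_baseSet
  mem_baseSet := c.mem_baseSet
  g i j x := β (c.g i j x)
  continuousOn_g i j := hβ.comp_continuousOn (c.continuousOn_g i j)
  g_self i x hx := by rw [c.g_self i x hx, map_one]
  g_mul_g i j k x hi hj hk := by rw [← map_mul, c.g_mul_g i j k x hi hj hk]

end PrincipalBundle

namespace Representation

variable {K F : Type*} [Group K] [AddCommGroup F] [Module ℂ F]

/-- The action of a group element as a linear isomorphism. -/
def linearEquiv (ρ : Representation ℂ K F) (h : K) : F ≃ₗ[ℂ] F :=
  LinearEquiv.ofLinearMap (ρ h) (ρ h⁻¹) (by rw [← Module.End.mul_eq_comp, ← map_mul]; simp; rfl)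
    (by rw [← Module.End.mul_eq_comp, ← map_mul]; simp; rfl)

end Representation

/-! ### The canonical model: cocycle identities -/

section Model

variable {G : Type u} [Group G] {H : Subgroup G}

theorem RightModuleMap.cocycle_mk (w : RightModuleMap H) (g₁ g : G) :
    w.cocycle g₁ (g : G ⧸ H) = w.toFun (g₁ * g) * (w.toFun g)⁻¹ := rfl

theorem RightModuleMap.cocycle_one (w : RightModuleMap H) (c : G ⧸ H) : w.cocycle 1 c = 1 := by
  obtain ⟨g, rfl⟩ := QuotientGroup.mk_surjective c
  simp [w.cocycle_mk]

variable [H.Normal]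

theorem RightModuleMap.cocycle_mul (w : RightModuleMap H) (g₁ g₂ : G) (c : G ⧸ H) :
    w.cocycle (g₁ * g₂) c = w.cocycle g₁ ((g₂ : G ⧸ H) * c) * w.cocycle g₂ c := by
  obtain ⟨g, rfl⟩ := QuotientGroup.mk_surjective c
  rw [← QuotientGroup.mk_mul, w.cocycle_mk, w.cocycle_mk, w.cocycle_mk]
  simp [mul_assoc]

theorem RightModuleMap.cocycle_coe_one (w : RightModuleMap H) (h : H) :
    w.cocycle (h : G) (1 : G ⧸ H) = w.toFun 1 * h * (w.toFun 1)⁻¹ := by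
  rw [← QuotientGroup.mk_one, w.cocycle_mk, mul_one, ← w.map_mul 1 h, one_mul]

theorem QuotientGroup.mk_coe_subgroup (h : H) : ((h : G) : G ⧸ H) = 1 :=
  (QuotientGroup.eq_one_iff _).mpr h.2

variable {F : Type u} [NormedAddCommGroup F] [NormedSpace ℂ F]

instance QuotientGroup.discreteTopology_of_discrete [TopologicalSpace G] [DiscreteTopology G] :
    DiscreteTopology (G ⧸ H) := QuotientGroup.discreteTopology (isOpen_discrete _)

/-- The representation of `H` in the fibre of the canonical model over the unit. -/
theorem Representation.map_cocycle_coe_one (ρ : Representation ℂ H F) (w : RightModuleMap H)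
    (h k : H) (v : F) :
    ρ (w.cocycle (h : G) 1) (ρ (w.cocycle (k : G) 1) v) = ρ (w.cocycle ((h * k : H) : G) 1) v := by
  rw [← Module.End.mul_apply, ← map_mul, w.cocycle_coe_one, w.cocycle_coe_one, w.cocycle_coe_one]
  congr 2
  group

section canonicalAct

variable (ρ : Representation ℂ H F) (w : RightModuleMap H)

theorem canonicalAct_one (x : CanonicalModel H F) : canonicalAct ρ w 1 x = x := by
  simp [canonicalAct, w.cocycle_one]

theorem canonicalAct_mul (g₁ g₂ : G) (x : CanonicalModel H F) :
    canonicalAct ρ w (g₁ * g₂) x = canonicalAct ρ w g₁ (canonicalAct ρ w g₂ x) := by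
  simp [canonicalAct, w.cocycle_mul, mul_assoc]

theorem continuous_canonicalAct [TopologicalSpace G] [DiscreteTopology G]
    [FiniteDimensional ℂ F] (g : G) :
    Continuous (canonicalAct ρ w g : CanonicalModel H F → CanonicalModel H F) := by
  refine continuous_prod_of_discrete_left.mpr fun c => ?_
  exact (continuous_const (y := (g : G ⧸ H) * c)).prodMk
    (LinearMap.continuous_of_finiteDimensional (ρ (w.cocycle g c)))

end canonicalAct

/-! ### The group `Aut_G(X_ρ)` and its topology -/

namespace AutG

variable [TopologicalSpace G] {ρ : Representation ℂ H F} {w : RightModuleMap H}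

@[simp]
theorem mul_apply (A B : AutG ρ w) (x : CanonicalModel H F) : (A * B).1 x = A.1 (B.1 x) := rfl

@[simp]
theorem one_apply (x : CanonicalModel H F) : (1 : AutG ρ w).1 x = x := rfl

@[simp]
theorem inv_apply_self (A : AutG ρ w) (x : CanonicalModel H F) : A⁻¹.1 (A.1 x) = x :=
  A.1.symm_apply_apply x

@[simp]
theorem apply_inv_self (A : AutG ρ w) (x : CanonicalModel H F) : A.1 (A⁻¹.1 x) = x :=
  A.1.apply_symm_apply x

theorem ext_apply {A B : AutG ρ w} (h : ∀ x, A.1 x = B.1 x) : A = B :=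
  Subtype.ext (Homeomorph.ext h)

theorem map_canonicalAct (A : AutG ρ w) (g : G) (x : CanonicalModel H F) :
    A.1 (canonicalAct ρ w g x) = canonicalAct ρ w g (A.1 x) := A.2.1 g x

/-- The bijection of the base covered by an automorphism. -/
noncomputable def base (A : AutG ρ w) : (G ⧸ H) ≃ (G ⧸ H) := A.2.2.choose

/-- The linear isomorphisms of the fibres given by an automorphism. -/
noncomputable def lin (A : AutG ρ w) : (G ⧸ H) → F ≃ₗ[ℂ] F := A.2.2.choose_spec.choose

theorem apply_mk (A : AutG ρ w) (c : G ⧸ H) (v : F) : A.1 (c, v) = (base A c, lin A c v) :=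
  A.2.2.choose_spec.choose_spec c v

theorem apply_eq (A : AutG ρ w) (x : CanonicalModel H F) :
    A.1 x = (base A x.1, lin A x.1 x.2) := apply_mk A x.1 x.2

/-- The base map commutes with the transitive left translations by `G`, hence is the right
translation by its value at `1`. -/
theorem base_eq (A : AutG ρ w) (c : G ⧸ H) : base A c = c * base A 1 := by
  obtain ⟨g, rfl⟩ := QuotientGroup.mk_surjective c
  have h := congrArg Prod.fst (map_canonicalAct A g (1, 0))
  simpa [canonicalAct, apply_mk] using h

theorem lin_mul (A B : AutG ρ w) (c : G ⧸ H) (v : F) :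
    lin (A * B) c v = lin A (base B c) (lin B c v) := by
  have h := mul_apply A B (c, v)
  rw [apply_mk, apply_mk, apply_mk] at h
  exact congrArg Prod.snd h

theorem base_mul (A B : AutG ρ w) (c : G ⧸ H) : base (A * B) c = base A (base B c) := by
  have h := mul_apply A B (c, 0)
  rw [apply_mk, apply_mk, apply_mk] at h
  exact congrArg Prod.fst h

theorem base_one (c : G ⧸ H) : base (1 : AutG ρ w) c = c := by
  have h := one_apply (ρ := ρ) (w := w) (c, 0)
  rw [apply_mk] at h
  exact congrArg Prod.fst h

theorem lin_one (c : G ⧸ H) (v : F) : lin (1 : AutG ρ w) c v = v := by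
  have h := one_apply (ρ := ρ) (w := w) (c, v)
  rw [apply_mk] at h
  exact congrArg Prod.snd h

variable (ρ w) in
/-- The homomorphism to `G ⧸ H` by which `Aut_G(X_ρ)` acts on the base of the canonical model:
`A⁻¹` covers right translation by the image of `A`. -/
noncomputable def toQuotient : AutG ρ w →* G ⧸ H where
  -- Since `base A` is right translation by `base A 1`, the map `A ↦ base A 1` reverses products;
  -- the inverse corrects this.
  toFun A := base A⁻¹ 1
  map_one' := by rw [inv_one, base_one]
  map_mul' A B := by rw [mul_inv_rev, base_mul, base_eq]

theorem base_inv_eq (A : AutG ρ w) (c : G ⧸ H) : base A⁻¹ c = c * toQuotient ρ w A :=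
  base_eq _ _

variable [DiscreteTopology G] [FiniteDimensional ℂ F]

/-- The automorphism with given base map and linear fibre maps. -/
def ofLinear (a : (G ⧸ H) ≃ (G ⧸ H)) (T : (G ⧸ H) → F ≃ₗ[ℂ] F)
    (h : ∀ g c v, (⟨a (canonicalAct ρ w g (c, v)).1, T (canonicalAct ρ w g (c, v)).1
      (canonicalAct ρ w g (c, v)).2⟩ : CanonicalModel H F) =
      canonicalAct ρ w g (a c, T c v)) : AutG ρ w :=
  ⟨{ toFun := fun x => (a x.1, T x.1 x.2)
     invFun := fun x => (a.symm x.1, (T (a.symm x.1)).symm x.2)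
     left_inv := fun x => by simp
     right_inv := fun x => by simp
     continuous_toFun := continuous_prod_of_discrete_left.mpr fun c =>
      (continuous_const (y := a c)).prodMk
        (LinearMap.continuous_of_finiteDimensional (T c).toLinearMap)
     continuous_invFun := continuous_prod_of_discrete_left.mpr fun c =>
      (continuous_const (y := a.symm c)).prodMk (LinearMap.continuous_of_finiteDimensional
        (T (a.symm c)).symm.toLinearMap) },
   fun g x => h g x.1 x.2, a, T, fun _ _ => rfl⟩

theorem continuous_apply : Continuous fun q : AutG ρ w × CanonicalModel H F => q.1.1 q.2 := by
  have : ProperSpace F := FiniteDimensional.proper ℂ F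
  have h : Continuous fun A : AutG ρ w => (A.1 : C(CanonicalModel H F, CanonicalModel H F)) :=
    continuous_fst.comp (continuous_induced_dom (t := inferInstance)
      (f := fun A : AutG ρ w => (((A.1 : C(CanonicalModel H F, CanonicalModel H F))),
        ((A.1.symm : C(CanonicalModel H F, CanonicalModel H F))))))
  exact (h.comp continuous_fst).eval continuous_snd

/-- The linear map induced on a fibre, as a continuous linear map. -/
noncomputable def clm (A : AutG ρ w) (c : G ⧸ H) : F ≃L[ℂ] F := (lin A c).toContinuousLinearEquiv

/-- The base maps are locally constant in `y` at each coset, and on a finite-dimensional fibre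
pointwise convergence of linear maps is norm convergence. Evaluation is therefore jointly
continuous; for the inverses, inversion is continuous at units of the algebra of operators. -/
theorem continuous_of_pointwise {Y : Type*} [TopologicalSpace Y] {A : Y → AutG ρ w}
    (hA : ∀ x, Continuous fun y => (A y).1 x) : Continuous A := by
  have hb : ∀ c, Continuous fun y => base (A y) c := fun c => by
    have := continuous_fst.comp (hA (c, 0))
    simpa [Function.comp_def, apply_mk] using this
  have hL : ∀ c, Continuous fun y => (clm (A y) c : F →L[ℂ] F) := fun c =>
    continuous_clm_apply.mpr fun v => by
      have := continuous_snd.comp (hA (c, v))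
      simp_rw [Function.comp_def, apply_mk] at this
      exact this
  have hev : ∀ y₀ c d, base (A y₀) c = d → ∀ᶠ y in 𝓝 y₀, base (A y) c = d := fun y₀ c d h =>
    (hb c).continuousAt.eventually ((isOpen_discrete {d}).mem_nhds h)
  refine continuous_induced_rng.mpr (Continuous.prodMk ?_ ?_)
  · refine ContinuousMap.continuous_of_continuous_uncurry _ ?_
    refine continuous_iff_continuousAt.mpr fun ⟨y₀, c₀, v₀⟩ => ?_
    have h1 : Continuous fun q : Y × CanonicalModel H F =>
        ((base (A q.1) c₀, clm (A q.1) c₀ q.2.2) : CanonicalModel H F) :=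
      ((hb c₀).comp continuous_fst).prodMk
        (((hL c₀).comp continuous_fst).clm_apply (continuous_snd.comp continuous_snd))
    refine h1.continuousAt.congr ?_
    have h2 : ∀ᶠ q in 𝓝 (y₀, (c₀, v₀)), (q : Y × CanonicalModel H F).2.1 = c₀ :=
      (by fun_prop : Continuous fun q : Y × CanonicalModel H F => q.2.1).continuousAt.eventually
        ((isOpen_discrete {c₀}).mem_nhds (Set.mem_singleton c₀))
    filter_upwards [h2] with q hq
    subst hq
    exact (apply_eq (A q.1) q.2).symm
  · refine ContinuousMap.continuous_of_continuous_uncurry _ ?_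
    refine continuous_iff_continuousAt.mpr fun ⟨y₀, c₀, v₀⟩ => ?_
    -- `A y` maps the coset `d` to `c₀` for all `y` near `y₀`, so there the inverse on the sheet
    -- `c₀` is inversion of the linear part at `d`.
    obtain ⟨d, hd⟩ := (base (A y₀)).surjective c₀
    have h1 : ContinuousAt (fun q : Y × CanonicalModel H F =>
        ((d, Ring.inverse (clm (A q.1) d : F →L[ℂ] F) q.2.2) : CanonicalModel H F))
        (y₀, (c₀, v₀)) := by
      refine continuousAt_const.prodMk (ContinuousAt.clm_apply ?_ (by fun_prop))
      have h3 : ContinuousAt Ring.inverse (clm (A y₀) d : F →L[ℂ] F) :=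
        NormedRing.inverse_continuousAt (ContinuousLinearEquiv.toUnit (clm (A y₀) d))
      exact ContinuousAt.comp (f := fun q : Y × CanonicalModel H F =>
        (clm (A q.1) d : F →L[ℂ] F)) (x := (y₀, (c₀, v₀))) h3
        ((hL d).comp continuous_fst).continuousAt
    refine h1.congr ?_
    have h2 : ∀ᶠ q in 𝓝 (y₀, (c₀, v₀)), (q : Y × CanonicalModel H F).2.1 = c₀ :=
      (by fun_prop : Continuous fun q : Y × CanonicalModel H F => q.2.1).continuousAt.eventually
        ((isOpen_discrete {c₀}).mem_nhds (Set.mem_singleton c₀))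
    have h4 : ∀ᶠ q in 𝓝 (y₀, (c₀, v₀)), base (A (q : Y × CanonicalModel H F).1) d = c₀ :=
      (continuous_fst.tendsto' (y₀, (c₀, v₀)) y₀ rfl).eventually (hev y₀ d c₀ hd)
    filter_upwards [h2, h4] with q hq hq'
    obtain ⟨y, c, v⟩ := q
    obtain rfl : c = c₀ := hq
    rw [ContinuousLinearMap.ringInverse_equiv, ContinuousLinearMap.inverse_equiv]
    refine (A y).1.injective ?_
    refine Eq.trans ?_ ((A y).1.apply_symm_apply (c, v)).symm
    rw [apply_mk]
    exact Prod.ext hq' ((clm (A y) d).apply_symm_apply v)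

/-- The topology of `Aut_G(X_ρ)` is the topology of pointwise convergence. -/
theorem isInducing_apply : IsInducing fun (A : AutG ρ w) (x : CanonicalModel H F) => A.1 x := by
  let r := Set.rangeFactorization fun (A : AutG ρ w) (x : CanonicalModel H F) => A.1 x
  -- `s` inverts the evaluation map on its range; it is continuous by `continuous_of_pointwise`, so
  -- the topology is induced from the range.
  let s : Set.range (fun (A : AutG ρ w) (x : CanonicalModel H F) => A.1 x) → AutG ρ w :=
    fun y => y.2.choose
  have hs : ∀ y x, (s y).1 x = y.1 x := fun y x => congrFun y.2.choose_spec x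
  have hr : Continuous r := Continuous.subtype_mk
    (continuous_pi fun x => continuous_apply.comp (by fun_prop : Continuous fun A => (A, x))) _
  have hsc : Continuous s := continuous_of_pointwise fun x => by
    simp_rw [hs]
    exact (_root_.continuous_apply x).comp continuous_subtype_val
  have hsr : s ∘ r = id := funext fun A => ext_apply fun x => hs (r A) x
  exact IsInducing.subtypeVal.comp (IsInducing.of_comp hr hsc (hsr ▸ IsInducing.id))

theorem continuousOn_iff {Y : Type*} [TopologicalSpace Y] {A : Y → AutG ρ w} {S : Set Y} :
    ContinuousOn A S ↔ ∀ x, ContinuousOn (fun y => (A y).1 x) S := by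
  rw [isInducing_apply.continuousOn_iff, continuousOn_pi]
  rfl

theorem continuous_toQuotient : Continuous (toQuotient ρ w) := by
  have h : Continuous fun A : AutG ρ w => ((A⁻¹).1 (1, 0)).1 :=
    continuous_fst.comp (continuous_apply.comp
      (by fun_prop : Continuous fun A : AutG ρ w => (A⁻¹, ((1, 0) : CanonicalModel H F))))
  simp_rw [apply_mk] at h
  exact h

end AutG

end Model

/-! ### Morphisms of equivariant bundles and frames -/

section

variable {G : Type u} [Group G] [TopologicalSpace G] {H : Subgroup G} [H.Normal]
  {F : Type u} [NormedAddCommGroup F] [NormedSpace ℂ F]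
  {X : Type u} [TopologicalSpace X] {ρ : Representation ℂ H F}

namespace VectG

variable {M : PrincipalBundle (G ⧸ H) X} (ξ : VectG ρ M)

theorem act_one (e : ξ.Total) : ξ.act 1 e = e := ξ.one_act e.proj e.2

theorem act_mul (g g' : G) (e : ξ.Total) : ξ.act (g * g') e = ξ.act g (ξ.act g' e) :=
  ξ.mul_act g g' e.proj e.2

@[simp]
theorem act_proj (g : G) (e : ξ.Total) : (ξ.act g e).proj = (g : G ⧸ H) • e.proj := rfl

theorem act_inv_act (g : G) (e : ξ.Total) : ξ.act g⁻¹ (ξ.act g e) = e := by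
  rw [← ξ.act_mul, inv_mul_cancel, ξ.act_one]

theorem act_act_inv (g : G) (e : ξ.Total) : ξ.act g (ξ.act g⁻¹ e) = e := by
  rw [← ξ.act_mul, mul_inv_cancel, ξ.act_one]

/-- The inverse is the action of `g⁻¹`. The argument runs on the total space because the fibres over
`g⁻¹ • g • m` and `m` are not definitionally the same. -/
theorem lin_bijective (g : G) (m : M.P) : Function.Bijective (ξ.lin g m) := by
  refine ⟨fun v v' hv => ?_, fun z => ?_⟩
  · have h1 : ξ.act g ⟨m, v⟩ = ξ.act g ⟨m, v'⟩ :=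
      congrArg (TotalSpace.mk ((g : G ⧸ H) • m)) hv
    have h2 := congrArg (ξ.act g⁻¹) h1
    rw [act_inv_act, act_inv_act] at h2
    exact TotalSpace.mk_injective m h2
  · obtain ⟨⟨n, v⟩, hv⟩ : ∃ e, e = ξ.act g⁻¹ ⟨(g : G ⧸ H) • m, z⟩ := ⟨_, rfl⟩
    have hn : n = m := by
      refine (congrArg TotalSpace.proj hv).trans ?_
      rw [act_proj, QuotientGroup.mk_inv, inv_smul_smul]
    subst hn
    refine ⟨v, TotalSpace.mk_injective (F := F) _ ?_⟩
    have h2 := congrArg (ξ.act g) hv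
    rw [act_act_inv] at h2
    exact h2

/-- The action of `g` as a linear isomorphism of fibres. -/
noncomputable def linEquiv (g : G) (m : M.P) : ξ.E m ≃ₗ[ℂ] ξ.E ((g : G ⧸ H) • m) :=
  LinearEquiv.ofBijective (ξ.lin g m) (ξ.lin_bijective g m)

theorem act_mk (g : G) (m : M.P) (v : ξ.E m) :
    ξ.act g ⟨m, v⟩ = ⟨(g : G ⧸ H) • m, ξ.linEquiv g m v⟩ := rfl

end VectG

namespace VectGUnion

@[simp]
theorem mapTotal_comp {U V W : VectGUnion X ρ} (f : U ⟶ V) (g : V ⟶ W) (e : U.ξ.Total) :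
    mapTotal (f ≫ g) e = mapTotal g (mapTotal f e) := rfl

theorem mapTotal_act {V W : VectGUnion X ρ} (f : V ⟶ W) (g : G) (e : V.ξ.Total) :
    mapTotal f (V.ξ.act g e) = W.ξ.act g (mapTotal f e) := (Hom.lift f).equivariant g e

theorem continuous_mapTotal {V W : VectGUnion X ρ} (f : V ⟶ W) : Continuous (mapTotal f) :=
  (Hom.lift f).continuous_total

theorem proj_mapTotal {V W : VectGUnion X ρ} (f : V ⟶ W) (e : V.ξ.Total) :
    W.M.proj (mapTotal f e).proj = V.M.proj e.proj :=
  PrincipalBundle.proj_map (Hom.base f) e.proj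

theorem hom_ext {V W : VectGUnion X ρ} {f g : V ⟶ W} (h : ∀ e, mapTotal f e = mapTotal g e) :
    f = g := by
  obtain ⟨φ, f⟩ := f
  obtain ⟨ψ, g⟩ := g
  obtain rfl : φ = ψ := PrincipalBundle.hom_ext fun m =>
    congrArg TotalSpace.proj (h ⟨m, 0⟩)
  congr 1
  refine VectG.HomOver.ext (funext fun m => LinearEquiv.ext fun v => ?_)
  exact TotalSpace.mk_injective _ (h ⟨m, v⟩)

/-- A continuous `G`-map over `X` between total spaces which is fibrewise a linear isomorphism is a
morphism. -/
theorem exists_hom_of_total {V W : VectGUnion X ρ} (t : V.ξ.Total → W.ξ.Total)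
    (ht : Continuous t)
    (hlin : ∀ m, ∃ (m' : W.M.P) (L : V.ξ.E m ≃ₗ[ℂ] W.ξ.E m'), ∀ v, t ⟨m, v⟩ = ⟨m', L v⟩)
    (hact : ∀ g e, t (V.ξ.act g e) = W.ξ.act g (t e))
    (hproj : ∀ e, W.M.proj (t e).proj = V.M.proj e.proj) :
    ∃ f : V ⟶ W, ∀ e, mapTotal f e = t e := by
  choose φ L hL using hlin
  -- The bundle projection is a quotient map, so the base map inherits continuity from `t`.
  have hφ : Continuous φ := by
    refine (FiberBundle.isQuotientMap_proj F V.ξ.E).continuous_iff.mpr ?_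
    refine ((FiberBundle.continuous_proj F W.ξ.E).comp ht).congr fun e => ?_
    exact congrArg TotalSpace.proj (hL e.proj e.2)
  have hL' : ∀ e : V.ξ.Total, (⟨φ e.proj, L e.proj e.2⟩ : W.ξ.Total) = t e :=
    fun e => (hL e.proj e.2).symm
  refine ⟨⟨⟨φ, hφ, fun c m => ?_, fun m => ?_⟩, ⟨L, ?_, fun g e => ?_⟩⟩, hL'⟩
  · obtain ⟨g, rfl⟩ := QuotientGroup.mk_surjective c
    have h := congrArg TotalSpace.proj (hact g ⟨m, 0⟩)
    rw [← hL', ← hL'] at h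
    exact h
  · have h := hproj ⟨m, 0⟩
    rw [← hL'] at h
    exact h
  · exact ht.congr fun e => (hL' e).symm
  · exact (hL' _).trans ((hact g e).trans (congrArg _ (hL' e).symm))

variable (w : RightModuleMap H)

/-- `f : X_ρ → ξ` is a frame at `x` if it is a `G`-equivariant isomorphism from the canonical model
to the restriction of `ξ` to the fibre of `M` over `x`. -/
structure IsFrame (V : VectGUnion X ρ) (x : X) (f : CanonicalModel H F → V.ξ.Total) : Prop where
  fibrewise : ∀ c, ∃ (m : V.M.P) (T : F ≃ₗ[ℂ] V.ξ.E m), ∀ v, f (c, v) = ⟨m, T v⟩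
  proj : ∀ z, V.M.proj (f z).proj = x
  act : ∀ g z, f (canonicalAct ρ w g z) = V.ξ.act g (f z)

namespace IsFrame

variable {w} {V : VectGUnion X ρ} {x : X} {f f' : CanonicalModel H F → V.ξ.Total}

theorem exists_fib (hf : IsFrame w V x f) (c : G ⧸ H) :
    ∃ T : F ≃ₗ[ℂ] V.ξ.E (f (c, 0)).proj, ∀ v, f (c, v) = ⟨(f (c, 0)).proj, T v⟩ := by
  obtain ⟨m, T, h⟩ := hf.fibrewise c
  obtain ⟨n, hn⟩ : ∃ n, n = (f (c, 0)).proj := ⟨_, rfl⟩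
  rw [← hn]
  rw [h] at hn
  subst hn
  exact ⟨T, h⟩

/-- By equivariance a frame covers an orbit map `c ↦ c • m`, where `m` is the image of the unit
coset. -/
theorem proj_apply (hf : IsFrame w V x f) (z : CanonicalModel H F) :
    (f z).proj = z.1 • (f (1, 0)).proj := by
  obtain ⟨c, v⟩ := z
  obtain ⟨T, hT⟩ := hf.exists_fib c
  have h1 : (f (c, v)).proj = (f (c, 0)).proj := by rw [hT v]
  rw [h1]
  obtain ⟨g, rfl⟩ := QuotientGroup.mk_surjective c
  have h2 := congrArg TotalSpace.proj (hf.act g (1, 0))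
  simpa [canonicalAct] using h2

theorem injective (hf : IsFrame w V x f) : Function.Injective f := by
  rintro ⟨c, v⟩ ⟨d, v'⟩ h
  have h1 := congrArg TotalSpace.proj h
  rw [hf.proj_apply (c, v), hf.proj_apply (d, v')] at h1
  obtain rfl : c = d := V.M.smul_left_injective _ h1
  obtain ⟨m, T, hT⟩ := hf.fibrewise c
  rw [hT, hT] at h
  rw [T.injective (TotalSpace.mk_injective _ h)]

/-- The fibre of `M` over `x` is a single `G ⧸ H`-orbit, and on each vector space fibre the frame is
onto. -/
theorem exists_apply_eq (hf : IsFrame w V x f) {e : V.ξ.Total} (he : V.M.proj e.proj = x) :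
    ∃ z, f z = e := by
  obtain ⟨c, hc, -⟩ := V.M.existsUnique_smul_eq ((hf.proj (1, 0)).trans he.symm)
  obtain ⟨T, hT⟩ := hf.exists_fib c
  have h1 := hf.proj_apply (c, 0)
  rw [← hc] at h1
  obtain ⟨m, v⟩ := e
  subst h1
  exact ⟨(c, T.symm v), by rw [hT]; simp⟩

theorem comp_aut (hf : IsFrame w V x f) (A : AutG ρ w) : IsFrame w V x fun z => f (A.1 z) where
  fibrewise c := by
    obtain ⟨T, hT⟩ := hf.exists_fib (AutG.base A c)
    exact ⟨_, (AutG.lin A c).trans T, fun v => by rw [AutG.apply_mk, hT]; rfl⟩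
  proj z := hf.proj _
  act g z := by rw [AutG.map_canonicalAct, hf.act]

theorem mapTotal {W : VectGUnion X ρ} (hf : IsFrame w V x f) (t : V ⟶ W) :
    IsFrame w W x fun z => mapTotal t (f z) where
  fibrewise c := by
    obtain ⟨T, hT⟩ := hf.exists_fib c
    exact ⟨_, T.trans ((Hom.lift t).fib _), fun v => by rw [hT]; rfl⟩
  proj z := by rw [proj_mapTotal, hf.proj]
  act g z := by rw [hf.act, mapTotal_act]

variable [DiscreteTopology G] [FiniteDimensional ℂ F]

/-- The automorphism is `f⁻¹ ∘ f'`: each fibre image of `f'` is also one of `f`, which gives base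
map and linear parts, and injectivity of `f` transfers equivariance. -/
theorem exists_transition (hf : IsFrame w V x f) (hf' : IsFrame w V x f') :
    ∃ A : AutG ρ w, ∀ z, f' z = f (A.1 z) := by
  have key : ∀ c, ∃ (d : G ⧸ H) (S : F ≃ₗ[ℂ] F), ∀ v, f' (c, v) = f (d, S v) := fun c => by
    obtain ⟨⟨d, v₀⟩, hd⟩ := hf.exists_apply_eq (hf'.proj (c, 0))
    obtain ⟨m, T', hT'⟩ := hf'.fibrewise c
    obtain ⟨n, T, hT⟩ := hf.fibrewise d
    obtain rfl : m = n := by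
      rw [hT, hT'] at hd
      exact (congrArg TotalSpace.proj hd).symm
    exact ⟨d, T'.trans T.symm, fun v => by rw [hT, hT']; simp⟩
  choose a S hS using key
  have hinj : Function.Injective a := fun c d hcd => by
    -- The vector over `c` is chosen so that `f'` maps it to `f' (d, 0)`.
    have h := hS c (S c |>.symm (S d 0))
    rw [LinearEquiv.apply_symm_apply, hcd, ← hS d] at h
    exact congrArg Prod.fst (hf'.injective h)
  have hsurj : Function.Surjective a := fun d => by
    obtain ⟨⟨c, v⟩, hc⟩ := hf'.exists_apply_eq (hf.proj (d, 0))
    rw [hS c v] at hc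
    exact ⟨c, congrArg Prod.fst (hf.injective hc)⟩
  refine ⟨AutG.ofLinear (Equiv.ofBijective a ⟨hinj, hsurj⟩) S fun g c v => hf.injective ?_,
    fun z => hS z.1 z.2⟩
  rw [hf.act]
  exact (hS _ _).symm.trans ((hf'.act g (c, v)).trans (congrArg _ (hS c v)))

end IsFrame

end VectGUnion

/-! ### Associated bundles: points of `P` as frames, and induced morphisms -/

namespace AssociatedBundle

variable {w : RightModuleMap H} {P : PrincipalBundle (AutG ρ w) X} {V : VectGUnion X ρ}

open VectGUnion

/-- A continuous family of frames, parametrized equivariantly by `P` and with local inverses,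
exhibits `V` as an associated bundle. -/
theorem nonempty_of_frames (eval : P.P → CanonicalModel H F → V.ξ.Total)
    (hframe : ∀ p, IsFrame w V (P.proj p) (eval p))
    (hsmul : ∀ (A : AutG ρ w) p x, eval (A • p) (A.1 x) = eval p x)
    (hcont : Continuous fun q : P.P × CanonicalModel H F => eval q.1 q.2)
    (hsec : ∀ x : X, ∃ U : Set X, IsOpen U ∧ x ∈ U ∧ ∃ (s : X → P.P)
      (κ : V.ξ.Total → CanonicalModel H F), ContinuousOn s U ∧
      ContinuousOn κ {e | V.M.proj e.proj ∈ U} ∧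
      ∀ e, V.M.proj e.proj ∈ U → eval (s (V.M.proj e.proj)) (κ e) = e) :
    Nonempty (AssociatedBundle P V) := by
  choose fib hfib using fun p c => (hframe p).exists_fib c
  have h : ∀ p (x : CanonicalModel H F),
      (⟨(eval p (x.1, 0)).proj, fib p x.1 x.2⟩ : V.ξ.Total) = eval p x :=
    fun p x => (hfib p x.1 x.2).symm
  have hπ : Continuous fun e : V.ξ.Total => V.M.proj e.proj :=
    V.M.continuous_proj.comp (FiberBundle.continuous_proj F V.ξ.E)
  refine ⟨⟨fun p c => (eval p (c, 0)).proj, fib, fun p c => (hframe p).proj _, ?_, ?_, ?_⟩⟩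
  · simp_rw [h]
    refine isQuotientMap_of_local_sections hcont fun e => ?_
    obtain ⟨U, hU, hx, s, κ, hs, hκ, hsκ⟩ := hsec (V.M.proj e.proj)
    exact ⟨_, hU.preimage hπ, hx, fun e => (s (V.M.proj e.proj), κ e),
      (hs.comp hπ.continuousOn fun _ he => he).prodMk hκ, hsκ⟩
  · intro p p' x x'
    rw [h, h]
    constructor
    · intro he
      have hp : P.proj p = P.proj p' := by
        rw [← (hframe p).proj x, ← (hframe p').proj x', he]
      obtain ⟨A, rfl, -⟩ := P.existsUnique_smul_eq hp
      refine ⟨A, rfl, (hframe (A • p)).injective ?_⟩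
      rw [hsmul, he]
    · rintro ⟨A, rfl, rfl⟩
      rw [hsmul]
  · intro g p x
    rw [h, h, (hframe p).act]

variable (a : AssociatedBundle P V)

theorem isFrame (p : P.P) : IsFrame w V (P.proj p) (a.eval p) where
  fibrewise c := ⟨a.base p c, a.fib p c, fun _ => rfl⟩
  proj z := a.proj_base p z.1
  act g z := a.equivariant g p z

theorem eval_smul (A : AutG ρ w) (p : P.P) (x : CanonicalModel H F) :
    a.eval (A • p) (A.1 x) = a.eval p x := ((a.eq_iff p (A • p) x (A.1 x)).mpr ⟨A, rfl, rfl⟩).symm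

theorem isQuotientMap_eval :
    IsQuotientMap fun q : P.P × CanonicalModel H F => a.eval q.1 q.2 := a.isQuotientMap

theorem exists_eval_eq (e : V.ξ.Total) : ∃ p x, a.eval p x = e :=
  let ⟨q, hq⟩ := a.isQuotientMap.surjective e
  ⟨q.1, q.2, hq⟩

/-- `p` and `q` differ by some `A`, and injectivity of the frame forces `A = 1`. -/
theorem eval_left_injective {p q : P.P} (h : ∀ x, a.eval p x = a.eval q x) : p = q := by
  obtain ⟨A, rfl, -⟩ := (a.eq_iff p q (1, 0) (1, 0)).mp (h _)
  obtain rfl : A = 1 := AutG.ext_apply fun x => (a.isFrame (A • p)).injective (by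
    rw [a.eval_smul, h]; rfl)
  rw [one_smul]

theorem hom_ext_eval {W : VectGUnion X ρ} {f g : V ⟶ W}
    (h : ∀ p x, mapTotal f (a.eval p x) = mapTotal g (a.eval p x)) : f = g :=
  VectGUnion.hom_ext fun e => by
    obtain ⟨p, x, rfl⟩ := a.exists_eval_eq e
    exact h p x

variable {Q : PrincipalBundle (AutG ρ w) X} {W : VectGUnion X ρ} (b : AssociatedBundle Q W)

/-- A morphism of principal bundles induces a morphism of associated bundles. -/
theorem exists_hom (f : P ⟶ Q) : ∃ g : V ⟶ W, ∀ p x,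
    mapTotal g (a.eval p x) = b.eval (PrincipalBundle.map f p) x := by
  -- This choice of preimages need not be continuous; `ht` shows that the resulting map does not
  -- depend on it, so its continuity can be tested on the quotient map from `P × X_ρ`.
  choose p z hpz using a.exists_eval_eq
  have ht : ∀ q x, b.eval (PrincipalBundle.map f (p (a.eval q x))) (z (a.eval q x)) =
      b.eval (PrincipalBundle.map f q) x := fun q x => by
    obtain ⟨A, h1, h2⟩ := (a.eq_iff _ _ _ _).mp (hpz (a.eval q x))
    have h3 : b.eval (PrincipalBundle.map f q) x =
        b.eval (PrincipalBundle.map f (A • p (a.eval q x))) (A.1 (z (a.eval q x))) := by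
      rw [← h1, ← h2]
    rw [h3, PrincipalBundle.map_smul, b.eval_smul]
  suffices h : ∃ g : V ⟶ W, ∀ e, mapTotal g e = b.eval (PrincipalBundle.map f (p e)) (z e) from
    h.imp fun g hg q x => (hg _).trans (ht q x)
  refine exists_hom_of_total (fun e => b.eval (PrincipalBundle.map f (p e)) (z e)) ?_ ?_ ?_ ?_
  · refine a.isQuotientMap_eval.continuous_iff.mpr ?_
    refine Continuous.congr ?_ fun q => (ht q.1 q.2).symm
    exact b.isQuotientMap_eval.continuous.comp
      (((PrincipalBundle.continuous_map f).comp continuous_fst).prodMk continuous_snd)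
  · intro m
    obtain ⟨q, x, hq⟩ := a.exists_eval_eq ⟨m, 0⟩
    obtain rfl : a.base q x.1 = m := congrArg TotalSpace.proj hq
    refine ⟨_, (a.fib q x.1).symm.trans (b.fib (PrincipalBundle.map f q) x.1), fun v => ?_⟩
    have h := ht q (x.1, (a.fib q x.1).symm v)
    have h' : a.eval q (x.1, (a.fib q x.1).symm v) = ⟨a.base q x.1, v⟩ :=
      congrArg (TotalSpace.mk _) ((a.fib q x.1).apply_symm_apply v)
    rw [h'] at h
    exact h
  · intro g e
    obtain ⟨q, x, rfl⟩ := a.exists_eval_eq e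
    rw [← (a.isFrame q).act, ht, ht, (b.isFrame _).act]
  · intro e
    obtain ⟨q, x, rfl⟩ := a.exists_eval_eq e
    rw [ht, (b.isFrame _).proj, (a.isFrame _).proj, PrincipalBundle.proj_map]

/-- Two bundles associated with the same principal bundle are isomorphic. -/
theorem nonempty_iso {W : VectGUnion X ρ} (a : AssociatedBundle P V) (b : AssociatedBundle P W) :
    Nonempty (V ≅ W) := by
  obtain ⟨f, hf⟩ := a.exists_hom b (𝟙 P)
  obtain ⟨g, hg⟩ := b.exists_hom a (𝟙 P)
  exact ⟨⟨f, g, a.hom_ext_eval fun p x => by rw [VectGUnion.mapTotal_comp, hf, hg]; rfl,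
    b.hom_ext_eval fun p x => by rw [VectGUnion.mapTotal_comp, hg, hf]; rfl⟩⟩

variable [DiscreteTopology G] [FiniteDimensional ℂ F]

/-- The frames given by a local section of `P` have a continuous inverse. -/
theorem exists_coframe {U : Set X} (hU : IsOpen U) {s : X → P.P} (hs : ContinuousOn s U)
    (hps : ∀ x ∈ U, P.proj (s x) = x) : ∃ κ : V.ξ.Total → CanonicalModel H F,
      ContinuousOn κ {e | V.M.proj e.proj ∈ U} ∧
      ∀ e, V.M.proj e.proj ∈ U → a.eval (s (V.M.proj e.proj)) (κ e) = e := by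
  have key : ∀ e : V.ξ.Total, ∃ z : CanonicalModel H F, V.M.proj e.proj ∈ U →
      a.eval (s (V.M.proj e.proj)) z = e := fun e => by
    by_cases he : V.M.proj e.proj ∈ U
    · obtain ⟨z, hz⟩ := (a.isFrame (s (V.M.proj e.proj))).exists_apply_eq (hps _ he).symm
      exact ⟨z, fun _ => hz⟩
    · exact ⟨(1, 0), fun h => absurd h he⟩
  choose κ hκ using key
  refine ⟨κ, ?_, hκ⟩
  have hO : IsOpen {e : V.ξ.Total | V.M.proj e.proj ∈ U} :=
    hU.preimage (V.M.continuous_proj.comp (FiberBundle.continuous_proj F V.ξ.E))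
  -- Upstairs on `P × X_ρ`, `κ` becomes `(p, x) ↦ div (s (proj p)) p` applied to `x`, which is
  -- visibly continuous.
  rw [a.isQuotientMap_eval.continuousOn_isOpen_iff hO]
  have hproj : ∀ q : P.P × CanonicalModel H F, V.M.proj (a.eval q.1 q.2).proj = P.proj q.1 :=
    fun q => (a.isFrame q.1).proj q.2
  have hpre : ((fun q : P.P × CanonicalModel H F => a.eval q.1 q.2) ⁻¹'
      {e | V.M.proj e.proj ∈ U}) = {q | P.proj q.1 ∈ U} := by
    ext q
    simp only [Set.mem_preimage, Set.mem_ofPred_eq, hproj]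
  rw [hpre]
  have hdiv : ContinuousOn (fun q : P.P × CanonicalModel H F => P.div (s (P.proj q.1)) q.1)
      {q | P.proj q.1 ∈ U} :=
    P.continuousOn_div (hs.comp (P.continuous_proj.comp continuous_fst).continuousOn fun _ h => h)
      continuousOn_fst fun q hq => (hps _ hq).symm
  refine (AutG.continuous_apply.comp_continuousOn (hdiv.prodMk continuousOn_snd)).congr ?_
  intro q hq
  have h1 := hκ (a.eval q.1 q.2) (by rw [hproj]; exact hq)
  rw [hproj] at h1
  refine (a.isFrame (s (P.proj q.1))).injective (h1.trans ?_)
  have h2 := a.eval_smul (P.div (s (P.proj q.1)) q.1) q.1 q.2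
  rw [P.div_smul (hps _ hq).symm] at h2
  exact h2.symm

/-- Every morphism of associated bundles is induced by a morphism of principal bundles. -/
theorem exists_principal_hom (g : V ⟶ W) : ∃ f : P ⟶ Q, ∀ p x,
    mapTotal g (a.eval p x) = b.eval (PrincipalBundle.map f p) x := by
  have key : ∀ p, ∃ q, Q.proj q = P.proj p ∧ ∀ x, mapTotal g (a.eval p x) = b.eval q x := by
    intro p
    obtain ⟨q, hq⟩ := Q.surjective_proj (P.proj p)
    -- The morphism `g` carries the frame of `p` to a frame of `W`; the transition from the frame of
    -- `q` tells how to correct `q`.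
    obtain ⟨A, hA⟩ := (hq ▸ b.isFrame q).exists_transition ((a.isFrame p).mapTotal g)
    refine ⟨A⁻¹ • q, by rw [Q.proj_smul, hq], fun x => ?_⟩
    rw [hA, ← b.eval_smul A⁻¹, AutG.inv_apply_self]
  choose f hfp hf using key
  refine ⟨⟨f, ?_, fun A p => ?_, hfp⟩, hf⟩
  · refine continuous_iff_continuousAt.mpr fun p₀ => ?_
    obtain ⟨U, hU, hx, s, hs, hps⟩ := Q.exists_section (P.proj p₀)
    obtain ⟨κ, hκ, hκs⟩ := b.exists_coframe hU hs hps
    have hmem : ∀ p x, P.proj p ∈ U → W.M.proj (mapTotal g (a.eval p x)).proj = P.proj p :=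
      fun p x _ => by rw [proj_mapTotal, (a.isFrame p).proj]
    have hO : IsOpen {p | P.proj p ∈ U} := hU.preimage P.continuous_proj
    -- Continuity into `AutG` is tested on each `x`, where the quotient `div` equals the coframe `κ`
    -- composed with the continuous map `mapTotal g`.
    have hA : ContinuousOn (fun p => Q.div (s (P.proj p)) (f p)) {p | P.proj p ∈ U} := by
      refine AutG.continuousOn_iff.mpr fun x => ?_
      have h1 : ContinuousOn (fun p => κ (mapTotal g (a.eval p x))) {p | P.proj p ∈ U} := by
        refine hκ.comp ((continuous_mapTotal g).comp (a.isQuotientMap_eval.continuous.comp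
          (by fun_prop : Continuous fun p : P.P => (p, x)))).continuousOn fun p hp => ?_
        simpa [hmem p x hp] using hp
      refine h1.congr fun p hp => ?_
      have h2 := hκs (mapTotal g (a.eval p x)) (by rw [hmem p x hp]; exact hp)
      rw [hmem p x hp] at h2
      refine (b.isFrame (s (P.proj p))).injective (Eq.trans ?_ h2.symm)
      have h3 := b.eval_smul (Q.div (s (P.proj p)) (f p)) (f p) x
      rw [Q.div_smul (by rw [hfp, hps _ hp])] at h3
      rw [h3, hf]
    have hf' : ContinuousOn (fun p => (Q.div (s (P.proj p)) (f p))⁻¹ • s (P.proj p))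
        {p | P.proj p ∈ U} :=
      Q.continuous_smul.comp_continuousOn
        (hA.inv.prodMk (hs.comp P.continuous_proj.continuousOn fun _ h => h))
    refine (hf'.continuousAt (hO.mem_nhds hx)).congr ?_
    filter_upwards [hO.mem_nhds hx] with p hp
    rw [inv_smul_eq_iff, Q.div_smul (by rw [hfp, hps _ hp])]
  -- Equivariance is checked on the induced frames, writing `x` as `A (A⁻¹ x)`.
  · refine b.eval_left_injective fun x => ?_
    rw [← hf]
    have h1 := b.eval_smul A (f p) (A⁻¹.1 x)
    have h2 := a.eval_smul A p (A⁻¹.1 x)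
    rw [AutG.apply_inv_self] at h1 h2
    rw [h1, h2, hf]

end AssociatedBundle

end

/-! ### Gluing the associated bundle from a cocycle -/

section

variable {G : Type u} [Group G] [TopologicalSpace G] [DiscreteTopology G] {H : Subgroup G}
  [H.Normal] {F : Type u} [NormedAddCommGroup F] [NormedSpace ℂ F] [FiniteDimensional ℂ F]
  {X : Type u} [TopologicalSpace X] {ρ : Representation ℂ H F} {w : RightModuleMap H}

namespace PrincipalBundle.Cocycle

variable (c : Cocycle (AutG ρ w) X)

/-- The cocycle of the principal `G ⧸ H`-bundle with fibre the base of the canonical model. -/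
noncomputable def baseCocycle : Cocycle (G ⧸ H) X :=
  c.map (AutG.toQuotient ρ w) AutG.continuous_toQuotient

theorem base_g_inv (i j x : X) (d : G ⧸ H) :
    AutG.base (c.g i j x)⁻¹ d = d * c.baseCocycle.g i j x := AutG.base_inv_eq _ _

theorem coord_baseCocycle (i : X) (m : c.baseCocycle.bundle.P) :
    c.baseCocycle.coord i m =
      AutG.base (c.g (c.baseCocycle.bundle.proj m) i (c.baseCocycle.bundle.proj m))⁻¹
        (c.baseCocycle.val m) := (c.base_g_inv _ _ _ _).symm

/-- The vector bundle over the associated `G ⧸ H`-bundle glued from the linear parts of the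
cocycle. -/
noncomputable def vectorCore : VectorBundleCore ℂ c.baseCocycle.bundle.P F X where
  baseSet i := {m | c.baseCocycle.bundle.proj m ∈ c.baseSet i}
  isOpen_baseSet i := (c.isOpen_baseSet i).preimage c.baseCocycle.bundle.continuous_proj
  indexAt m := c.baseCocycle.bundle.proj m
  mem_baseSet_at m := c.mem_baseSet _
  -- A point with coordinate `l` in `P` sends `z` to the point with coordinate `l⁻¹ z`; as `l`
  -- changes to `l * g`, the coordinate in `X_ρ` changes by `g⁻¹`. Its linear part depends on the
  -- sheet, hence on the coordinate of `m`.
  coordChange i j m := AutG.clm (c.g i j (c.baseCocycle.bundle.proj m))⁻¹ (c.baseCocycle.coord i m)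
  coordChange_self i m hm v := by
    change AutG.lin (c.g i i _)⁻¹ _ v = v
    rw [c.g_self i _ hm, inv_one, AutG.lin_one]
  continuousOn_coordChange i j := by
    refine continuousOn_clm_apply.mpr fun v => ?_
    have h1 : ContinuousOn (fun m : c.baseCocycle.bundle.P =>
        (c.g i j (c.baseCocycle.bundle.proj m))⁻¹.1 (c.baseCocycle.coord i m, v))
        {m | c.baseCocycle.bundle.proj m ∈ c.baseSet i ∩ c.baseSet j} := by
      refine AutG.continuous_apply.comp_continuousOn (ContinuousOn.prodMk ?_ ?_)
      · exact ((c.continuousOn_g i j).comp c.baseCocycle.bundle.continuous_proj.continuousOn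
          fun _ h => h).inv
      · exact ((c.baseCocycle.continuousOn_coord i).mono fun _ h => h.1).prodMk continuousOn_const
    refine (continuous_snd.comp_continuousOn h1).congr fun m _ => ?_
    simp only [Function.comp_apply]
    rw [AutG.apply_mk]
    rfl
  coordChange_comp i j k m hm v := by
    change AutG.lin _ _ (AutG.lin _ _ v) = AutG.lin _ _ v
    have h1 : c.baseCocycle.coord j m =
        AutG.base (c.g i j (c.baseCocycle.bundle.proj m))⁻¹ (c.baseCocycle.coord i m) := by
      rw [base_g_inv, c.baseCocycle.coord_mul_g hm.1.1 hm.1.2]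
    rw [h1, ← AutG.lin_mul, ← mul_inv_rev, c.g_mul_g i j k _ hm.1.1 hm.1.2 hm.2]

/-- The point of the glued vector bundle over `x` with coordinates `z ∈ X_ρ` in the open set indexed
by `x`. -/
noncomputable def totalPt (x : X) (z : CanonicalModel H F) : TotalSpace F c.vectorCore.Fiber :=
  ⟨c.baseCocycle.pt x z.1, z.2⟩

/-- The coordinates in `X_ρ` of a point over `x` in the open set indexed by `x`. -/
noncomputable def totalVal (e : TotalSpace F c.vectorCore.Fiber) : CanonicalModel H F :=
  (c.baseCocycle.val e.proj, (e.2 : F))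

/-- The point of `X` under a point of the glued vector bundle. -/
noncomputable def totalProj (e : TotalSpace F c.vectorCore.Fiber) : X :=
  c.baseCocycle.bundle.proj e.proj

/-- The coordinates in `X_ρ` of a point over the `i`-th open set. -/
noncomputable def totalCoord (i : X) (e : TotalSpace F c.vectorCore.Fiber) : CanonicalModel H F :=
  (c.g (c.totalProj e) i (c.totalProj e))⁻¹.1 (c.totalVal e)

@[simp]
theorem totalPt_totalVal (e : TotalSpace F c.vectorCore.Fiber) :
    c.totalPt (c.totalProj e) (c.totalVal e) = e := rfl

theorem totalCoord_eq (i : X) (e : TotalSpace F c.vectorCore.Fiber) :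
    c.totalCoord i e = (c.baseCocycle.coord i e.proj, (c.vectorCore.localTriv i e).2) := by
  refine (AutG.apply_eq _ _).trans (Prod.ext (c.coord_baseCocycle i e.proj).symm ?_)
  rw [VectorBundleCore.localTriv_apply]
  change AutG.lin _ _ _ = AutG.lin (c.g (c.totalProj e) i (c.totalProj e))⁻¹
    (c.baseCocycle.coord (c.totalProj e) e.proj) _
  rw [totalProj, c.baseCocycle.coord_proj]
  rfl

/-- By `totalCoord_eq` the two successive charts, of `M` and of the vector bundle over it, combine
into one chart with values in `X_ρ`. -/
theorem continuousAt_totalSpace_iff {Y : Type*} [TopologicalSpace Y]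
    {f : Y → TotalSpace F c.vectorCore.Fiber} {y : Y} {i : X}
    (hi : c.totalProj (f y) ∈ c.baseSet i) :
    ContinuousAt f y ↔ ContinuousAt (fun y => c.totalProj (f y)) y ∧
      ContinuousAt (fun y => c.totalCoord i (f y)) y := by
  have hb : ContinuousAt (fun y => (f y).proj) y ↔
      ContinuousAt (fun y => c.totalProj (f y)) y ∧
        ContinuousAt (fun y => c.baseCocycle.coord i (f y).proj) y :=
    c.baseCocycle.continuousAt_iff hi
  simp_rw [c.totalCoord_eq]
  constructor
  · intro h
    have h1 : ContinuousAt (fun y => (f y).proj) y :=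
      (FiberBundle.continuous_proj F c.vectorCore.Fiber).continuousAt.comp h
    refine ⟨(hb.mp h1).1, (hb.mp h1).2.prodMk (continuousAt_snd.comp (ContinuousAt.comp ?_ h))⟩
    exact (c.vectorCore.localTriv i).continuousAt
      ((c.vectorCore.localTriv i).mem_source.mpr hi)
  · rintro ⟨h1, h2⟩
    have h3 := hb.mpr ⟨h1, continuousAt_fst.comp h2⟩
    refine (c.vectorCore.localTriv i).continuousAt_of_comp_left h3 hi ?_
    exact h3.prodMk (continuousAt_snd.comp h2)

/-- The `G`-equivariant vector bundle glued from a cocycle. -/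
noncomputable def vectG : VectG ρ c.baseCocycle.bundle where
  E := c.vectorCore.Fiber
  lin g m := (ρ (w.cocycle g (c.baseCocycle.val m)) : F →ₗ[ℂ] F)
  one_act m v := congrArg (c.totalPt (c.baseCocycle.bundle.proj m))
    (canonicalAct_one ρ w (c.baseCocycle.val m, (v : F)))
  mul_act g g' m v := congrArg (c.totalPt (c.baseCocycle.bundle.proj m))
    (canonicalAct_mul ρ w g g' (c.baseCocycle.val m, (v : F)))
  -- The transition automorphisms commute with `G`, so the action is `canonicalAct` in every chart.
  continuous_act g := by
    change Continuous fun e => c.totalPt (c.totalProj e) (canonicalAct ρ w g (c.totalVal e))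
    refine continuous_iff_continuousAt.mpr fun e₀ => ?_
    have h := (c.continuousAt_totalSpace_iff (f := id) (y := e₀) (c.mem_baseSet _)).mp
      continuousAt_id
    refine (c.continuousAt_totalSpace_iff (i := c.totalProj e₀) (c.mem_baseSet _)).mpr ⟨h.1, ?_⟩
    refine ((continuous_canonicalAct ρ w g).continuousAt.comp h.2).congr (.of_forall fun e => ?_)
    exact (AutG.map_canonicalAct _ g _).symm
  type_rho m := by
    -- At the point of the orbit with coordinate `1`, `h` acts by `ρ (u(1) h u(1)⁻¹)`, and `ρ
    -- (u(1))` conjugates this to `ρ`.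
    let S : F ≃ₗ[ℂ] F := ρ.linearEquiv (w.toFun 1)
    refine ⟨(c.baseCocycle.val m)⁻¹, S, fun h v => ?_⟩
    have h1 : canonicalAct ρ w h (1, S v) = (1, S (ρ h v)) := by
      refine Prod.ext (by simp [canonicalAct, QuotientGroup.mk_coe_subgroup]) ?_
      change ρ _ (ρ _ v) = ρ _ (ρ _ v)
      rw [w.cocycle_coe_one, ← Module.End.mul_apply, ← Module.End.mul_apply, ← map_mul,
        ← map_mul, inv_mul_cancel_right]
    have h2 : c.baseCocycle.val ((c.baseCocycle.val m)⁻¹ • m) = 1 := by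
      rw [c.baseCocycle.val_smul, inv_mul_cancel]
    have h3 : ∀ u : F, (⟨(c.baseCocycle.val m)⁻¹ • m, u⟩ : TotalSpace F c.vectorCore.Fiber) =
        c.totalPt (c.baseCocycle.bundle.proj m) (1, u) := fun u => by
      rw [← h2]; rfl
    refine Eq.trans ?_ ((congrArg (c.totalPt _) h1).trans (h3 _).symm)
    rw [← h2]
    rfl

end PrincipalBundle.Cocycle

open PrincipalBundle

/-- The bundle with fibre `X_ρ` associated with a principal `Aut_G(X_ρ)`-bundle. -/
noncomputable def PrincipalBundle.associated (P : PrincipalBundle (AutG ρ w) X) :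
    VectGUnion X ρ := ⟨P.cocycle.baseCocycle.bundle, P.cocycle.vectG⟩

theorem PrincipalBundle.nonempty_associatedBundle (P : PrincipalBundle (AutG ρ w) X) :
    Nonempty (AssociatedBundle P P.associated) := by
  -- Relative to the chosen section, `p` has coordinate `l` and acts as the frame `z ↦ l⁻¹ z`.
  let ev : P.P → CanonicalModel H F → P.associated.ξ.Total := fun p z =>
    P.cocycle.totalPt (P.proj p) ((P.div p (P.sectionAt (P.proj p) (P.proj p)))⁻¹.1 z)
  have hsec : ∀ x : X, P.proj (P.sectionAt x x) = x := fun x =>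
    P.proj_sectionAt (P.mem_sectionNhd x)
  refine AssociatedBundle.nonempty_of_frames ev (fun p => ?_) (fun A p z => ?_) ?_ fun i => ?_
  · refine ⟨fun c => ?_, fun z => rfl, fun g z => ?_⟩
    · let A : AutG ρ w := (P.div p (P.sectionAt (P.proj p) (P.proj p)))⁻¹
      refine ⟨P.cocycle.baseCocycle.pt (P.proj p) (AutG.base A c), AutG.lin A c, fun v => ?_⟩
      exact congrArg (P.cocycle.totalPt (P.proj p)) (AutG.apply_mk _ c v)
    · exact congrArg (P.cocycle.totalPt (P.proj p)) (AutG.map_canonicalAct _ g z)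
  · simp only [ev]
    rw [P.proj_smul, P.smul_div (hsec _), mul_inv_rev, AutG.mul_apply, AutG.inv_apply_self]
  · have hcoord : ∀ i (q : P.P × CanonicalModel H F), P.proj q.1 ∈ P.sectionNhd i →
        P.cocycle.totalCoord i (ev q.1 q.2) =
          (P.div q.1 (P.sectionAt i (P.proj q.1)))⁻¹.1 q.2 := fun i q hq => by
      have h1 := P.div_mul_div (p := P.sectionAt i (P.proj q.1))
        (q := P.sectionAt (P.proj q.1) (P.proj q.1)) (r := q.1)
        (by rw [P.proj_sectionAt hq, hsec]) (hsec _)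
      rw [← h1, mul_inv_rev]
      rfl
    refine continuous_iff_continuousAt.mpr fun q₀ => ?_
    refine (P.cocycle.continuousAt_totalSpace_iff (i := P.proj q₀.1)
      (P.mem_sectionNhd _)).mpr ⟨(P.continuous_proj.comp continuous_fst).continuousAt, ?_⟩
    have hO : IsOpen {q : P.P × CanonicalModel H F | P.proj q.1 ∈ P.sectionNhd (P.proj q₀.1)} :=
      (P.isOpen_sectionNhd _).preimage (P.continuous_proj.comp continuous_fst)
    have hdiv : ContinuousOn (fun q : P.P × CanonicalModel H F =>
        P.div q.1 (P.sectionAt (P.proj q₀.1) (P.proj q.1)))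
        {q | P.proj q.1 ∈ P.sectionNhd (P.proj q₀.1)} :=
      P.continuousOn_div continuousOn_fst ((P.continuousOn_sectionAt _).comp
        (P.continuous_proj.comp continuous_fst).continuousOn fun _ h => h)
        fun q hq => P.proj_sectionAt hq
    refine ContinuousOn.continuousAt ?_ (hO.mem_nhds (P.mem_sectionNhd _))
    exact (AutG.continuous_apply.comp_continuousOn (hdiv.inv.prodMk continuousOn_snd)).congr
      fun q hq => hcoord _ q hq
  · refine ⟨P.sectionNhd i, P.isOpen_sectionNhd i, P.mem_sectionNhd i, P.sectionAt i,
      P.cocycle.totalCoord i, P.continuousOn_sectionAt i, fun e he => ?_, fun e he => ?_⟩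
    · exact ((P.cocycle.continuousAt_totalSpace_iff (f := id) (y := e) he).mp
        continuousAt_id).2.continuousWithinAt
    · have hev : ∀ p z y, P.proj p = y →
          ev p z = P.cocycle.totalPt y ((P.div p (P.sectionAt y y))⁻¹.1 z) := by
        rintro p z _ rfl; rfl
      refine (hev _ _ _ (P.proj_sectionAt he)).trans ?_
      refine Eq.trans (congrArg (P.cocycle.totalPt _) ?_) (P.cocycle.totalPt_totalVal e)
      -- Passing from the own chart of `e` to chart `i` and back is the identity.
      have h1 := P.cocycle.g_mul_g_symm (P.mem_sectionNhd (P.cocycle.totalProj e)) he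
      refine Eq.trans (b := (P.cocycle.g (P.cocycle.totalProj e) i (P.cocycle.totalProj e) *
        P.cocycle.g i (P.cocycle.totalProj e) (P.cocycle.totalProj e))⁻¹.1
          (P.cocycle.totalVal e)) (by rw [mul_inv_rev]; rfl) ?_
      refine (congrArg (fun A : AutG ρ w => A⁻¹.1 (P.cocycle.totalVal e)) h1).trans ?_
      rw [inv_one, AutG.one_apply]

end

/-! ### Local equivariant trivializations by averaging over `H` -/

section

variable {G : Type u} [Group G] [TopologicalSpace G] {H : Subgroup G}
  [H.Normal] {F : Type u} [NormedAddCommGroup F] [NormedSpace ℂ F] [FiniteDimensional ℂ F]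
  {X : Type u} [TopologicalSpace X] {ρ : Representation ℂ H F}

namespace VectGUnion

/-- Averaging over the finite group `H`: near every point there is a section `s` of `M` and an
`H`-equivariant trivialization of the restriction of `ξ` to it. -/
theorem exists_equivariant_trivialization [Finite H] (w : RightModuleMap H) (V : VectGUnion X ρ)
    (x₀ : X) :
    ∃ U : Set X, IsOpen U ∧ x₀ ∈ U ∧ ∃ (s : X → V.M.P) (Ψ : X → F → V.ξ.Total)
      (Θ : V.ξ.Total → F), ContinuousOn s U ∧ (∀ x ∈ U, V.M.proj (s x) = x) ∧
      (∀ x ∈ U, ∃ T : F ≃ₗ[ℂ] V.ξ.E (s x), ∀ v, Ψ x v = ⟨s x, T v⟩) ∧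
      ContinuousOn (fun q : X × F => Ψ q.1 q.2) {q | q.1 ∈ U} ∧
      ContinuousOn Θ {e | V.M.proj e.proj ∈ U ∧ e.proj = s (V.M.proj e.proj)} ∧
      (∀ x ∈ U, ∀ e : V.ξ.Total, e.proj = s x → Ψ x (Θ e) = e) ∧
      ∀ x ∈ U, ∀ (h : H) v, V.ξ.act h (Ψ x v) = Ψ x (ρ (w.cocycle (h : G) 1) v) := by
  have := Fintype.ofFinite H
  obtain ⟨m₀, T₀, hm₀, hT₀⟩ : ∃ (m₀ : V.M.P) (T₀ : F ≃ₗ[ℂ] V.ξ.E m₀), V.M.proj m₀ = x₀ ∧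
      ∀ (h : H) (v : F), V.ξ.act h ⟨m₀, T₀ v⟩ = ⟨m₀, T₀ (ρ (w.cocycle (h : G) 1) v)⟩ := by
    obtain ⟨m, hm⟩ := V.M.surjective_proj x₀
    obtain ⟨c, T, hT⟩ := V.ξ.type_rho m
    -- Over the unit coset the model carries the conjugate of `ρ` by `u(1)`; precomposing with `ρ
    -- (u(1)⁻¹)` matches it.
    refine ⟨c • m, (ρ.linearEquiv (w.toFun 1)⁻¹).trans T, by rw [V.M.proj_smul, hm], fun h v => ?_⟩
    refine (hT h _).trans ?_
    refine congrArg (fun u => (⟨c • m, T u⟩ : V.ξ.Total)) ?_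
    change ρ _ (ρ _ v) = ρ _ (ρ _ v)
    rw [← Module.End.mul_apply, ← map_mul, ← Module.End.mul_apply, ← map_mul, w.cocycle_coe_one]
    congr 2
    group
  subst hm₀
  obtain ⟨U₀, hU₀, hx₀, s, hs, hps, hs₀⟩ := V.M.exists_section_through m₀
  set x₀ := V.M.proj m₀
  let τ := trivializationAt F V.ξ.E m₀
  have hτ₀ : m₀ ∈ τ.baseSet := mem_baseSet_trivializationAt F V.ξ.E m₀
  let U₁ := U₀ ∩ s ⁻¹' τ.baseSet
  have hU₁ : IsOpen U₁ := hs.isOpen_inter_preimage hU₀ τ.open_baseSet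
  have hxU₁ : x₀ ∈ U₁ := ⟨hx₀, by rw [Set.mem_preimage, hs₀]; exact hτ₀⟩
  have hsU₁ : ContinuousOn s U₁ := hs.mono fun _ h => h.1
  let Φ : X → F → V.ξ.Total := fun x v => τ.toOpenPartialHomeomorph.symm (s x, v)
  have hΦ : ∀ x, x ∈ U₁ → ∀ v, Φ x v = ⟨s x, τ.symmₗ ℂ (s x) v⟩ := fun x hx v => by
    rw [Trivialization.symmₗ_apply τ hx.2, τ.mk_symm hx.2]
  have hΦ_proj : ∀ x ∈ U₁, ∀ v, (Φ x v).proj = s x := fun x hx v => τ.proj_symm_apply' hx.2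
  have hτΦ : ∀ x ∈ U₁, ∀ v, (τ (Φ x v)).2 = v := fun x hx v => by
    rw [show τ (Φ x v) = (s x, v) from τ.apply_symm_apply' hx.2]
  have hΦτ : ∀ x ∈ U₁, ∀ e : V.ξ.Total, e.proj = s x → Φ x (τ e).2 = e := fun x hx e he => by
    have h1 : e ∈ τ.source := τ.mem_source.mpr (by rw [he]; exact hx.2)
    change τ.toOpenPartialHomeomorph.symm (s x, (τ e).2) = e
    rw [← he]
    exact τ.symm_apply_mk_proj h1
  have hΦc : ContinuousOn (fun q : X × F => Φ q.1 q.2) {q | q.1 ∈ U₁} :=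
    τ.continuousOn_invFun.comp ((hsU₁.comp continuousOn_fst fun _ h => h).prodMk continuousOn_snd)
      fun q hq => τ.mem_target.mpr hq.2
  have hact_proj : ∀ (h : H) (e : V.ξ.Total), (V.ξ.act h e).proj = e.proj := fun h e => by
    rw [VectG.act_proj, QuotientGroup.mk_coe_subgroup, one_smul]
  -- `H` fixes every point of `M`, so in the trivialization it acts on each fibre by operators on
  -- `F`; these vary continuously with `x`.
  let R : H → X → F →L[ℂ] F := fun h x => LinearMap.toContinuousLinearMap
    (τ.linearMapAt ℂ (((h : G) : G ⧸ H) • s x) ∘ₗ V.ξ.lin h (s x) ∘ₗ τ.symmₗ ℂ (s x))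
  have hR : ∀ h, ∀ x ∈ U₁, ∀ v, R h x v = (τ (V.ξ.act h (Φ x v))).2 := fun h x hx v => by
    have h1 : ((h : G) : G ⧸ H) • s x ∈ τ.baseSet := by
      rw [QuotientGroup.mk_coe_subgroup, one_smul]; exact hx.2
    rw [hΦ x hx]
    exact congrFun (τ.coe_linearMapAt_of_mem (R := ℂ) h1) (V.ξ.lin h (s x) (τ.symmₗ ℂ (s x) v))
  have hactΦ : ∀ h : H, ∀ x ∈ U₁, ∀ v, V.ξ.act h (Φ x v) = Φ x (R h x v) := fun h x hx v => by
    rw [hR h x hx, hΦτ x hx]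
    rw [hact_proj, hΦ_proj x hx]
  have hRmul : ∀ h k, ∀ x ∈ U₁, ∀ v, R (h * k) x v = R h x (R k x v) := fun h k x hx v => by
    rw [hR (h * k) x hx, hR h x hx, ← hactΦ k x hx, ← V.ξ.act_mul]
    rfl
  have hRc : ∀ h, ContinuousOn (R h) U₁ := fun h => by
    refine continuousOn_clm_apply.mpr fun v => ?_
    have h1 : ContinuousOn (fun x => V.ξ.act h (Φ x v)) U₁ :=
      (V.ξ.continuous_act h).comp_continuousOn (hΦc.comp
        (by fun_prop : Continuous fun x : X => (x, v)).continuousOn fun _ h => h)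
    refine (continuous_snd.comp_continuousOn (τ.continuousOn.comp h1 fun x hx => ?_)).congr
      fun x hx => hR h x hx v
    exact τ.mem_source.mpr (by rw [hact_proj, hΦ_proj x hx]; exact hx.2)
  let S₀ : F ≃L[ℂ] F :=
    (T₀.trans (τ.continuousLinearEquivAt ℂ m₀ hτ₀).toLinearEquiv).toContinuousLinearEquiv
  have hS₀ : ∀ v, Φ x₀ (S₀ v) = ⟨m₀, T₀ v⟩ := fun v =>
    hΦτ x₀ hxU₁ ⟨m₀, T₀ v⟩ hs₀.symm
  let σ : H → F →L[ℂ] F := fun h => LinearMap.toContinuousLinearMap (ρ (w.cocycle (h : G) 1))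
  have hσ : ∀ h v, σ h v = ρ (w.cocycle (h : G) 1) v := fun _ _ => rfl
  have hσmul : ∀ h k v, σ h (σ k v) = σ (h * k) v := fun h k v => ρ.map_cocycle_coe_one w h k v
  have hσone : ∀ v, σ 1 v = v := fun v => by
    rw [hσ, OneMemClass.coe_one, w.cocycle_one, map_one]; rfl
  -- The average, not normalized, of the conjugates of `S₀`. It intertwines `σ` with `R` at every
  -- point of `U₁`.
  let A : X → F →L[ℂ] F := fun x => ∑ h : H, R h x ∘L (S₀ : F →L[ℂ] F) ∘L σ h⁻¹
  have hA : ∀ x v, A x v = ∑ h : H, R h x (S₀ (σ h⁻¹ v)) := fun x v => by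
    simp [A]
  have hAc : ContinuousOn A U₁ :=
    continuousOn_finsetSum _ fun h _ => (hRc h).clm_comp continuousOn_const
  have hAeq : ∀ k, ∀ x ∈ U₁, ∀ v, R k x (A x v) = A x (σ k v) := fun k x hx v => by
    rw [hA, hA, map_sum]
    refine Fintype.sum_equiv (Equiv.mulLeft k) _ _ fun h => ?_
    rw [Equiv.coe_mulLeft, hσmul, ← hRmul k h x hx, mul_inv_rev, inv_mul_cancel_right]
  -- `S₀` already intertwines the actions at `x₀`, so all summands there equal `S₀`. Hence `A x₀` is
  -- invertible, and by openness of the units so is `A x` nearby.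
  have hA₀ : A x₀ = Units.mk0 (Fintype.card H : ℂ) (by simp) • (S₀ : F →L[ℂ] F) := by
    ext v
    rw [hA]
    have : ∀ h : H, R h x₀ (S₀ (σ h⁻¹ v)) = S₀ v := fun h => by
      rw [hR h x₀ hxU₁, hS₀, hT₀, ← hS₀, hτΦ x₀ hxU₁, ← hσ, hσmul, mul_inv_cancel, hσone]
    simp only [this, Finset.sum_const, Finset.card_univ]
    rw [← Nat.cast_smul_eq_nsmul ℂ]
    rfl
  have hAunit₀ : IsUnit (A x₀) := by
    rw [hA₀]
    exact IsUnit.smul _ (ContinuousLinearEquiv.toUnit S₀).isUnit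
  let U := U₁ ∩ A ⁻¹' {B | IsUnit B}
  have hU : IsOpen U := hAc.isOpen_inter_preimage hU₁ Units.isOpen
  refine ⟨U, hU, ⟨hxU₁, hAunit₀⟩, s, fun x v => Φ x (A x v),
    fun e => Ring.inverse (A (V.M.proj e.proj)) (τ e).2, hsU₁.mono fun _ h => h.1,
    fun x hx => hps x hx.1.1, fun x hx => ?_, ?_, ?_, fun x hx e he => ?_, fun x hx h v => ?_⟩
  · obtain ⟨B, hB⟩ := hx.2
    refine ⟨(ContinuousLinearEquiv.ofUnit B).toLinearEquiv.trans
      (τ.continuousLinearEquivAt ℂ (s x) hx.1.2).symm.toLinearEquiv, fun v => ?_⟩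
    refine (hΦ x hx.1 _).trans ?_
    rw [← hB]
    simp only [LinearEquiv.trans_apply, ContinuousLinearEquiv.coe_toLinearEquiv,
      Trivialization.symm_continuousLinearEquivAt_eq]
    rfl
  · refine hΦc.comp (continuousOn_fst.prodMk (ContinuousOn.clm_apply
      (hAc.comp continuousOn_fst fun q hq => hq.1) continuousOn_snd)) fun q hq => hq.1
  · refine ContinuousOn.clm_apply ?_ (continuous_snd.comp_continuousOn
      (τ.continuousOn.mono fun e he => τ.mem_source.mpr (by rw [he.2]; exact he.1.1.2)))
    have h1 : ContinuousOn (fun x => Ring.inverse (A x)) U := by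
      intro x hx
      obtain ⟨B, hB⟩ := hx.2
      have h2 : ContinuousAt Ring.inverse (A x) := hB ▸ NormedRing.inverse_continuousAt B
      exact h2.comp_continuousWithinAt ((hAc x hx.1).mono fun _ h => h.1)
    exact h1.comp (V.M.continuous_proj.comp
      (FiberBundle.continuous_proj F V.ξ.E)).continuousOn fun e he => he.1
  · have h1 : V.M.proj e.proj = x := by rw [he, hps x hx.1.1]
    simp only [h1]
    rw [← mul_apply_eq_comp, Ring.mul_inverse_cancel _ hx.2]
    exact hΦτ x hx.1 e he
  · rw [hactΦ h x hx.1, hAeq h x hx.1]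
    rfl

end VectGUnion

end

/-! ### Local frames and the frame bundle -/

section

variable {G : Type u} [Group G] [TopologicalSpace G] [DiscreteTopology G] {H : Subgroup G}
  [H.Normal] {F : Type u} [NormedAddCommGroup F] [NormedSpace ℂ F] [FiniteDimensional ℂ F]
  {X : Type u} [TopologicalSpace X] {ρ : Representation ℂ H F}

namespace VectGUnion

/-- Near every point there is a continuous family of frames with a continuous inverse. -/
theorem exists_local_frame [Finite H] (w : RightModuleMap H) (V : VectGUnion X ρ) (x₀ : X) :
    ∃ U : Set X, IsOpen U ∧ x₀ ∈ U ∧ ∃ (Ψ : X → CanonicalModel H F → V.ξ.Total)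
      (Θ : V.ξ.Total → CanonicalModel H F), (∀ x ∈ U, IsFrame w V x (Ψ x)) ∧
      ContinuousOn (fun q : X × CanonicalModel H F => Ψ q.1 q.2) {q | q.1 ∈ U} ∧
      ContinuousOn Θ {e | V.M.proj e.proj ∈ U} ∧
      ∀ e, V.M.proj e.proj ∈ U → Ψ (V.M.proj e.proj) (Θ e) = e := by
  obtain ⟨U, hU, hx₀, s, Ψ, Θ, hs, hps, hlin, hΨ, hΘ, hΨΘ, hact⟩ :=
    V.exists_equivariant_trivialization w x₀
  have hfst : ∀ z : CanonicalModel H F, ∀ g : G, (g : G ⧸ H) = z.1 →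
      canonicalAct ρ w g⁻¹ z = (1, (canonicalAct ρ w g⁻¹ z).2) := fun z g hg =>
    Prod.ext (by simp [canonicalAct, ← hg]) rfl
  have hcan : ∀ (h : H) (v : F), canonicalAct ρ w (h : G) (1, v) =
      (1, ρ (w.cocycle (h : G) 1) v) := fun h v =>
    Prod.ext (by simp [canonicalAct, QuotientGroup.mk_coe_subgroup]) rfl
  -- Equivariance forces this formula: move `z` to the unit coset, apply `Ψ`, and move back.
  let E : X → CanonicalModel H F → V.ξ.Total := fun x z =>
    V.ξ.act z.1.out (Ψ x (canonicalAct ρ w z.1.out⁻¹ z).2)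
  -- Representatives of a coset differ by elements of `H`, under which `Ψ` is equivariant, so any
  -- representative may be used.
  have hE : ∀ x ∈ U, ∀ (z : CanonicalModel H F) (g : G), (g : G ⧸ H) = z.1 →
      E x z = V.ξ.act g (Ψ x (canonicalAct ρ w g⁻¹ z).2) := fun x hx z g hg => by
    obtain ⟨k, hk⟩ : ∃ k : H, g = z.1.out * k :=
      ⟨⟨z.1.out⁻¹ * g, QuotientGroup.eq.mp (by rw [hg, QuotientGroup.out_eq'])⟩, by simp⟩
    have h1 := hfst z z.1.out (QuotientGroup.out_eq' _)
    have h2 : canonicalAct ρ w (k : G) (canonicalAct ρ w g⁻¹ z) =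
        canonicalAct ρ w z.1.out⁻¹ z := by
      rw [← canonicalAct_mul, hk, mul_inv_rev, mul_inv_cancel_left]
    rw [hfst z g hg, hcan] at h2
    rw [hk, V.ξ.act_mul, hact x hx, ← hk]
    exact congrArg (fun y : CanonicalModel H F => V.ξ.act z.1.out (Ψ x y.2)) h2.symm
  have hloc : ∀ {Y : Type u} [TopologicalSpace Y] (f : Y → G ⧸ H) (S : Set Y),
      ContinuousOn f S → ∀ y ∈ S, ∀ᶠ y' in 𝓝[S] y, f y' = f y := fun f S hf y hy =>
    (hf y hy).eventually ((isOpen_discrete {f y}).mem_nhds (Set.mem_singleton _))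
  refine ⟨U, hU, hx₀, E, fun e => canonicalAct ρ w (V.M.div e.proj (s (V.M.proj e.proj))).out
    (1, Θ (V.ξ.act (V.M.div e.proj (s (V.M.proj e.proj))).out⁻¹ e)),
    fun x hx => ⟨fun c => ?_, fun z => ?_, fun g z => ?_⟩, ?_, ?_, fun e he => ?_⟩
  · obtain ⟨T, hT⟩ := hlin x hx
    refine ⟨((c.out : G) : G ⧸ H) • s x, (ρ.linearEquiv (w.cocycle c.out⁻¹ c)).trans
      (T.trans (V.ξ.linEquiv c.out (s x))), fun v => ?_⟩
    change V.ξ.act c.out (Ψ x _) = _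
    rw [hT, V.ξ.act_mk]
    rfl
  · obtain ⟨T, hT⟩ := hlin x hx
    change V.M.proj (V.ξ.act _ (Ψ x _)).proj = x
    rw [hT, VectG.act_proj, V.M.proj_smul, hps x hx]
  · rw [hE x hx (canonicalAct ρ w g z) (g * z.1.out) (by
      rw [QuotientGroup.mk_mul, QuotientGroup.out_eq']; rfl), V.ξ.act_mul, ← canonicalAct_mul,
      mul_inv_rev, inv_mul_cancel_right]
  · intro q₀ hq₀
    have h1 : ContinuousOn (fun q : X × CanonicalModel H F =>
        V.ξ.act q₀.2.1.out (Ψ q.1 (canonicalAct ρ w q₀.2.1.out⁻¹ q.2).2)) {q | q.1 ∈ U} := by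
      have h2 : Continuous fun q : X × CanonicalModel H F =>
          (q.1, (canonicalAct ρ w q₀.2.1.out⁻¹ q.2).2) := continuous_fst.prodMk
        (continuous_snd.comp ((continuous_canonicalAct ρ w _).comp continuous_snd))
      exact (V.ξ.continuous_act _).comp_continuousOn
        (hΨ.comp h2.continuousOn fun q hq => hq)
    refine (h1 q₀ hq₀).congr_of_eventuallyEq ?_ rfl
    filter_upwards [hloc (fun q : X × CanonicalModel H F => q.2.1) {q | q.1 ∈ U}
      (by fun_prop) q₀ hq₀] with q hq
    simp only [E, hq]
  · have hπ : Continuous fun e : V.ξ.Total => V.M.proj e.proj :=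
      V.M.continuous_proj.comp (FiberBundle.continuous_proj F V.ξ.E)
    have hsπ : ContinuousOn (fun e : V.ξ.Total => s (V.M.proj e.proj))
        {e | V.M.proj e.proj ∈ U} := hs.comp hπ.continuousOn fun _ h => h
    have hdiv : ContinuousOn (fun e : V.ξ.Total => V.M.div e.proj (s (V.M.proj e.proj)))
        {e | V.M.proj e.proj ∈ U} :=
      V.M.continuousOn_div (FiberBundle.continuous_proj F V.ξ.E).continuousOn hsπ
        fun e he => hps _ he
    intro e₀ he₀
    set c := V.M.div e₀.proj (s (V.M.proj e₀.proj)) with hc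
    have hev := hloc _ _ hdiv e₀ he₀
    -- The coset of `e` relative to `s` is locally constant, so near `e₀` a single representative
    -- serves.
    let S := {e : V.ξ.Total | V.M.proj e.proj ∈ U ∧
      V.M.div e.proj (s (V.M.proj e.proj)) = c}
    have h1 : ContinuousOn (fun e => canonicalAct ρ w c.out (1, Θ (V.ξ.act c.out⁻¹ e))) S := by
      refine (continuous_canonicalAct ρ w _).comp_continuousOn (continuousOn_const.prodMk ?_)
      refine hΘ.comp (V.ξ.continuous_act _).continuousOn fun e he => ?_
      have h2 : V.M.proj (V.ξ.act c.out⁻¹ e).proj = V.M.proj e.proj := by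
        rw [VectG.act_proj, V.M.proj_smul]
      refine ⟨by rw [h2]; exact he.1, ?_⟩
      rw [h2, VectG.act_proj, QuotientGroup.mk_inv, QuotientGroup.out_eq', inv_smul_eq_iff, ← he.2,
        V.M.div_smul (hps _ he.1)]
    have h3 : ContinuousWithinAt (fun e => canonicalAct ρ w c.out (1, Θ (V.ξ.act c.out⁻¹ e)))
        {e | V.M.proj e.proj ∈ U} e₀ :=
      (h1 e₀ ⟨he₀, rfl⟩).mono_of_mem_nhdsWithin (by
        filter_upwards [hev, self_mem_nhdsWithin] with e h h' using ⟨h', h⟩)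
    refine h3.congr_of_eventuallyEq ?_ rfl
    filter_upwards [hev] with e h
    simp only [h, ← hc]
  · set c := V.M.div e.proj (s (V.M.proj e.proj)) with hc
    have hcs : c • s (V.M.proj e.proj) = e.proj := V.M.div_smul (hps _ he)
    rw [hE _ he _ c.out (by simp [canonicalAct, hc]), ← canonicalAct_mul, inv_mul_cancel,
      canonicalAct_one, hΨΘ _ he, V.ξ.act_act_inv]
    rw [VectG.act_proj, QuotientGroup.mk_inv, QuotientGroup.out_eq', inv_smul_eq_iff, hcs]

/-- Every object is associated with a principal `Aut_G(X_ρ)`-bundle, the bundle of its frames. -/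
theorem exists_associatedBundle [Finite H] (w : RightModuleMap H) (V : VectGUnion X ρ) :
    ∃ P : PrincipalBundle (AutG ρ w) X, Nonempty (AssociatedBundle P V) := by
  choose U hU hxU Ψ Θ hframe hΨ hΘ hΨΘ using fun x₀ => V.exists_local_frame w x₀
  -- Outside `U i ∩ U j` the default transition `1` is irrelevant.
  have hg : ∀ i j x, ∃ A : AutG ρ w, x ∈ U i → x ∈ U j → ∀ z, Ψ j x z = Ψ i x (A.1 z) := by
    intro i j x
    by_cases hi : x ∈ U i
    · by_cases hj : x ∈ U j
      · obtain ⟨A, hA⟩ := (hframe i x hi).exists_transition (hframe j x hj)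
        exact ⟨A, fun _ _ => hA⟩
      · exact ⟨1, fun _ h => absurd h hj⟩
    · exact ⟨1, fun h => absurd h hi⟩
  choose g hg using hg
  let c : PrincipalBundle.Cocycle (AutG ρ w) X :=
    { baseSet := U
      isOpen_baseSet := hU
      mem_baseSet := hxU
      g := g
      -- Pointwise, the transition automorphism is `Θ i (Ψ j x z)`.
      continuousOn_g := fun i j => AutG.continuousOn_iff.mpr fun z => by
        have h1 : ContinuousOn (fun x => Θ i (Ψ j x z)) (U i ∩ U j) := by
          refine (hΘ i).comp ((hΨ j).comp
            (by fun_prop : Continuous fun x : X => (x, z)).continuousOn fun x hx => hx.2)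
            fun x hx => ?_
          change V.M.proj (Ψ j x z).proj ∈ U i
          rw [(hframe j x hx.2).proj]
          exact hx.1
        refine h1.congr fun x hx => (hframe i x hx.1).injective ?_
        have h2 := hΨΘ i (Ψ j x z) (by rw [(hframe j x hx.2).proj]; exact hx.1)
        rw [(hframe j x hx.2).proj] at h2
        rw [h2, hg i j x hx.1 hx.2]
      g_self := fun i x hx => AutG.ext_apply fun z =>
        (hframe i x hx).injective (hg i i x hx hx z).symm
      g_mul_g := fun i j k x hi hj hk => AutG.ext_apply fun z =>
        (hframe i x hi).injective (by
          rw [AutG.mul_apply, ← hg i j x hi hj, ← hg j k x hj hk, ← hg i k x hi hk]) }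
  -- A point with coordinate `A` is the local frame precomposed with `A⁻¹`; `hev` shows that this is
  -- the same in every chart.
  let ev : c.bundle.P → CanonicalModel H F → V.ξ.Total := fun p z =>
    Ψ (c.bundle.proj p) (c.bundle.proj p) ((c.val p)⁻¹.1 z)
  have hev : ∀ i p z, c.bundle.proj p ∈ U i →
      ev p z = Ψ i (c.bundle.proj p) ((c.coord i p)⁻¹.1 z) := fun i p z hi => by
    have h1 : c.coord i p = c.val p * g (c.bundle.proj p) i (c.bundle.proj p) := rfl
    rw [h1, mul_inv_rev, hg _ _ _ (hxU _) hi, ← AutG.mul_apply, mul_inv_cancel_left]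
  refine ⟨c.bundle, AssociatedBundle.nonempty_of_frames ev
    (fun p => (hframe _ _ (hxU _)).comp_aut _) (fun A p z => ?_) ?_ fun i => ?_⟩
  · change Ψ (c.bundle.proj (A • p)) _ _ = Ψ _ _ _
    rw [c.val_smul, mul_inv_rev, AutG.mul_apply, AutG.inv_apply_self, c.bundle.proj_smul]
  · refine continuous_iff_continuousAt.mpr fun q₀ => ?_
    have hO : IsOpen {q : c.bundle.P × CanonicalModel H F |
        c.bundle.proj q.1 ∈ U (c.bundle.proj q₀.1)} :=
      (hU _).preimage (c.bundle.continuous_proj.comp continuous_fst)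
    refine ContinuousOn.continuousAt ?_ (hO.mem_nhds (hxU _))
    refine ContinuousOn.congr ?_ fun q hq => hev (c.bundle.proj q₀.1) q.1 q.2 hq
    refine (hΨ (c.bundle.proj q₀.1)).comp (ContinuousOn.prodMk
      (c.bundle.continuous_proj.comp continuous_fst).continuousOn ?_) fun q hq => hq
    refine AutG.continuous_apply.comp_continuousOn (ContinuousOn.prodMk ?_ continuousOn_snd)
    exact ((c.continuousOn_coord (c.bundle.proj q₀.1)).comp continuousOn_fst fun q hq => hq).inv
  · refine ⟨U i, hU i, hxU i, c.unitSection i, Θ i, c.continuousOn_unitSection i, hΘ i,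
      fun e he => ?_⟩
    have h1 : ∀ x ∈ U i, ∀ z, ev (c.unitSection i x) z = Ψ i x z := fun x hx z => by
      change Ψ x x ((g i x x)⁻¹.1 z) = Ψ i x z
      rw [hg i x x hx (hxU x), AutG.apply_inv_self]
    rw [h1 _ he, hΨΘ i e he]

end VectGUnion

/-! ### The functor and the equivalence -/

namespace AssociatedBundle

variable {w : RightModuleMap H}

variable (ρ w X) in
/-- The functor replacing the fibre `Aut_G(X_ρ)` by `X_ρ`. -/
noncomputable def functor : PrincipalBundle (AutG ρ w) X ⥤ VectGUnion X ρ where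
  obj P := P.associated
  -- The chosen morphism is determined by its values on the frames, by `hom_ext_eval`; this makes
  -- the choice functorial.
  map {P Q} f := (P.nonempty_associatedBundle.some.exists_hom
    Q.nonempty_associatedBundle.some f).choose
  map_id P := P.nonempty_associatedBundle.some.hom_ext_eval fun p x =>
    (P.nonempty_associatedBundle.some.exists_hom P.nonempty_associatedBundle.some
      (𝟙 P)).choose_spec p x
  map_comp {P Q R} f g := P.nonempty_associatedBundle.some.hom_ext_eval fun p x => by
    rw [VectGUnion.mapTotal_comp, Exists.choose_spec (P.nonempty_associatedBundle.some.exists_hom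
      R.nonempty_associatedBundle.some (f ≫ g)), Exists.choose_spec
      (P.nonempty_associatedBundle.some.exists_hom Q.nonempty_associatedBundle.some f),
      Exists.choose_spec (Q.nonempty_associatedBundle.some.exists_hom
        R.nonempty_associatedBundle.some g)]
    rfl

/-- The value of the functor on `P` is associated with `P`. -/
noncomputable def functorObj (P : PrincipalBundle (AutG ρ w) X) :
    AssociatedBundle P ((functor X ρ w).obj P) := P.nonempty_associatedBundle.some

theorem mapTotal_functor_map {P Q : PrincipalBundle (AutG ρ w) X} (f : P ⟶ Q) (p : P.P)
    (x : CanonicalModel H F) : VectGUnion.mapTotal ((functor X ρ w).map f)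
      ((functorObj P).eval p x) = (functorObj Q).eval (PrincipalBundle.map f p) x :=
  Exists.choose_spec (P.nonempty_associatedBundle.some.exists_hom
    Q.nonempty_associatedBundle.some f) p x

/-- A point of `Q` is determined by the frame it induces. -/
instance : (functor X ρ w).Faithful where
  map_injective {P Q} f g h := PrincipalBundle.hom_ext fun p =>
    (functorObj Q).eval_left_injective fun x => by
      rw [← mapTotal_functor_map, ← mapTotal_functor_map, h]

instance : (functor X ρ w).Full where
  map_surjective {P Q} g := by
    obtain ⟨f, hf⟩ := (functorObj P).exists_principal_hom (functorObj Q) g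
    exact ⟨f, (functorObj P).hom_ext_eval fun p x => by rw [mapTotal_functor_map, hf]⟩

/-- `V` and the image of its frame bundle are both associated with the same principal bundle, hence
isomorphic. -/
instance [Finite H] : (functor X ρ w).EssSurj where
  mem_essImage V := by
    obtain ⟨P, ⟨a⟩⟩ := V.exists_associatedBundle w
    exact ⟨P, (functorObj P).nonempty_iso a⟩

instance [Finite H] : (functor X ρ w).IsEquivalence where

end AssociatedBundle

end

theorem theorem2 {G : Type u} [Group G] [TopologicalSpace G] [DiscreteTopology G]
    (H : Subgroup G) [H.Normal] [Finite H]
    {F : Type u} [NormedAddCommGroup F] [NormedSpace ℂ F] [FiniteDimensional ℂ F]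
    (ρ : Representation ℂ H F) (w : RightModuleMap H)
    (X : Type u) [TopologicalSpace X] [CompactSpace X] :
    ∃ (Φ : PrincipalBundle (AutG ρ w) X ≌ VectGUnion X ρ)
      (a : ∀ P : PrincipalBundle (AutG ρ w) X, AssociatedBundle P (Φ.functor.obj P)),
      ∀ (P Q : PrincipalBundle (AutG ρ w) X) (f : P ⟶ Q) (p : P.P) (x : CanonicalModel H F),
        VectGUnion.mapTotal (Φ.functor.map f) ((a P).eval p x) =
          (a Q).eval (PrincipalBundle.map f p) x := by
  exact ⟨(AssociatedBundle.functor X ρ w).asEquivalence, AssociatedBundle.functorObj,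
    fun _ _ f p x => AssociatedBundle.mapTotal_functor_map f p x⟩
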